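/- A theory $T$ is \emph{finite-dimensional} if there is a function $\dim$ from the class of all interpretable sets (definable sets modulo definable equivalence relations, parameters allowed) in models of $T$ to $\omega\cup\{-\infty\}$ such that, for all interpretable sets $X,Y$ in a model of $T$ and every $k\in\omega$: \begin{itemize} \item if $\varphi(x,y)$ is a formula and $a,a'$ are tuples, in models of $T$, with the same type over $\emptyset$, then $\dim(\varphi(x,a))=\dim(\varphi(x,a'))$, also when $x$ ranges over the quotient by an equivalence relation defined by a formula $\varepsilon(x,x',y)$ with the same parameters $a$, respectively $a'$; \item $\dim(\emptyset)=-\infty$, and $\dim(X)=0$ if and only if $X$ is finite and non-empty; \item $\dim(X\cup Y)=\max\{\dim(X),\dim(Y)\}$; \item if $f:X\to Y$ is interpretable and $\dim(f^{-1}(y))\ge k$ for all $y\in Y$, then $\dim(X)\ge\dim(Y)+k$; \item if $f:X\to Y$ is interpretable and $\dim(f^{-1}(y))\le k$ for all $y\in Y$, then $\dim(X)\le\dim(Y)+k$. \end{itemize} \textbf{Theorem.} Let $T$ be a finite-dimensional theory, let $M$ be a model of $T$, and let $\mathfrak{g}$ be a Lie ring definable in $M$: its underlying set (a definable set or, more generally,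 a definable subset of the quotient of some $M^n$ by a definable equivalence relation), its addition and its bracket are definable in $M$, with parameters. Then the Fitting ideal $F(\mathfrak{g})$, i.e. the sum of all ideals of $\mathfrak{g}$ (definable or not) that are nilpotent as Lie rings, is nilpotent and is definable in $M$, with parameters. -/

import Mathlib

open FirstOrder FirstOrder.Language

universe u v w

namespace Interp

section Sets

variable (L : FirstOrder.Language.{u, v}) {M : Type w} [L.Structure M] {n m : ℕ}

/-- The equivalence relation `E` on `M ^ n` is definable, with parameters from `M`. -/
def DefinableRel (E : Setoid (Fin n → M)) : Prop :=
  (Set.univ : Set M).Definable L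
    {p : Fin n ⊕ Fin n → M | E (fun i => p (Sum.inl i)) (fun i => p (Sum.inr i))}

/-- For a definable equivalence relation `E` on `M ^ n`, the subset `X` of `M ^ n / E` is
interpretable: its preimage in `M ^ n` is definable, with parameters from `M`.
If `E` is equality, these are the definable subsets of `M ^ n`. -/
def InterpretableSet (E : Setoid (Fin n → M)) (X : Set (Quotient E)) : Prop :=
  (Set.univ : Set M).Definable L {x : Fin n → M | Quotient.mk E x ∈ X}

/-- The map `f : X → Y` between interpretable sets `X ⊆ M ^ n / E` and `Y ⊆ M ^ m / F` is
interpretable: (the preimage in `M ^ (n + m)` of) its graph is definable, with parameters. -/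
def InterpretableFun {E : Setoid (Fin n → M)} {F : Setoid (Fin m → M)}
    {X : Set (Quotient E)} {Y : Set (Quotient F)} (f : X → Y) : Prop :=
  (Set.univ : Set M).Definable L
    {p : Fin n ⊕ Fin m → M | ∃ h : Quotient.mk E (fun i => p (Sum.inl i)) ∈ X,
      (f ⟨Quotient.mk E (fun i => p (Sum.inl i)), h⟩ : Quotient F) =
        Quotient.mk F (fun i => p (Sum.inr i))}

end Sets

section Dimension

variable {L : FirstOrder.Language.{u, v}} (T : L.Theory)

/-- `dim` is a dimension on the interpretable sets of the models of `T`, with values in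
`ω ∪ {-∞}`. Its values at sets that are not interpretable are irrelevant. -/
structure IsDimension
    (dim : ∀ (M : Theory.ModelType.{u, v, w} T) (n : ℕ) (E : Setoid (Fin n → M)),
      Set (Quotient E) → WithBot ℕ) : Prop where
  /-- Invariance: the dimension of the set defined by a formula `φ(x, a)`, in the quotient by the
  equivalence relation defined by `ε(x, x', a)`, depends only on the type of `a` over `∅`. -/
  invariant : ∀ (n k : ℕ) (ε : L.Formula ((Fin n ⊕ Fin n) ⊕ Fin k))
    (φ : L.Formula (Fin n ⊕ Fin k)) (M N : Theory.ModelType.{u, v, w} T)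
    (a : Fin k → M) (b : Fin k → N) (E : Setoid (Fin n → M)) (F : Setoid (Fin n → N))
    (X : Set (Quotient E)) (Y : Set (Quotient F)),
    T.typeOf a = T.typeOf b →
    (∀ x x', E x x' ↔ ε.Realize (Sum.elim (Sum.elim x x') a)) →
    (∀ y y', F y y' ↔ ε.Realize (Sum.elim (Sum.elim y y') b)) →
    (∀ x, Quotient.mk E x ∈ X ↔ φ.Realize (Sum.elim x a)) →
    (∀ y, Quotient.mk F y ∈ Y ↔ φ.Realize (Sum.elim y b)) →
    dim M n E X = dim N n F Y
  empty : ∀ (M : Theory.ModelType.{u, v, w} T) (n : ℕ) (E : Setoid (Fin n → M)),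
    DefinableRel L E → dim M n E ∅ = ⊥
  eq_zero_iff : ∀ (M : Theory.ModelType.{u, v, w} T) (n : ℕ) (E : Setoid (Fin n → M))
    (X : Set (Quotient E)), DefinableRel L E → InterpretableSet L E X →
    (dim M n E X = 0 ↔ X.Nonempty ∧ X.Finite)
  union : ∀ (M : Theory.ModelType.{u, v, w} T) (n : ℕ) (E : Setoid (Fin n → M))
    (X Y : Set (Quotient E)), DefinableRel L E → InterpretableSet L E X →
    InterpretableSet L E Y → dim M n E (X ∪ Y) = max (dim M n E X) (dim M n E Y)
  le_of_fibers : ∀ (M : Theory.ModelType.{u, v, w} T) (n m : ℕ) (E : Setoid (Fin n → M))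
    (F : Setoid (Fin m → M)) (X : Set (Quotient E)) (Y : Set (Quotient F)) (f : X → Y) (k : ℕ),
    DefinableRel L E → DefinableRel L F → InterpretableSet L E X → InterpretableSet L F Y →
    InterpretableFun L f → (∀ y : Y, (k : WithBot ℕ) ≤ dim M n E (Subtype.val '' (f ⁻¹' {y}))) →
    dim M m F Y + k ≤ dim M n E X
  ge_of_fibers : ∀ (M : Theory.ModelType.{u, v, w} T) (n m : ℕ) (E : Setoid (Fin n → M))
    (F : Setoid (Fin m → M)) (X : Set (Quotient E)) (Y : Set (Quotient F)) (f : X → Y) (k : ℕ),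
    DefinableRel L E → DefinableRel L F → InterpretableSet L E X → InterpretableSet L F Y →
    InterpretableFun L f → (∀ y : Y, dim M n E (Subtype.val '' (f ⁻¹' {y})) ≤ (k : WithBot ℕ)) →
    dim M n E X ≤ dim M m F Y + k

/-- The theory `T` is finite-dimensional. -/
def IsFiniteDimensionalTheory : Prop :=
  ∃ dim : ∀ (M : Theory.ModelType.{u, v, w} T) (n : ℕ) (E : Setoid (Fin n → M)),
    Set (Quotient E) → WithBot ℕ, IsDimension T dim

end Dimension

section LieRings

variable (L : FirstOrder.Language.{u, v}) (M : Type w) [L.Structure M]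

/-- A realisation of the Lie ring `g` as a definable Lie ring in `M`: a bijection of `g` with a
definable set, or more generally with a definable subset of the quotient of some `M ^ n` by a
definable equivalence relation `rel`, for which the addition and the bracket are definable. -/
structure DefinableLieRing (g : Type*) [LieRing g] where
  /-- The exponent `n`. -/
  arity : ℕ
  /-- The equivalence relation; it is equality if `g` lives on a definable subset of `M ^ n`. -/
  rel : Setoid (Fin arity → M)
  /-- The identification of the elements of `g` with elements of `M ^ n / rel`. -/
  coord : g → Quotient rel
  coord_injective : Function.Injective coord
  definable_rel : DefinableRel L rel
  definable_range : InterpretableSet L rel (Set.range coord)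
  definable_add : (Set.univ : Set M).Definable L
    {p : Fin arity ⊕ Fin arity ⊕ Fin arity → M | ∃ x y : g,
      coord x = Quotient.mk rel (fun i => p (Sum.inl i)) ∧
      coord y = Quotient.mk rel (fun i => p (Sum.inr (Sum.inl i))) ∧
      coord (x + y) = Quotient.mk rel (fun i => p (Sum.inr (Sum.inr i)))}
  definable_lie : (Set.univ : Set M).Definable L
    {p : Fin arity ⊕ Fin arity ⊕ Fin arity → M | ∃ x y : g,
      coord x = Quotient.mk rel (fun i => p (Sum.inl i)) ∧
      coord y = Quotient.mk rel (fun i => p (Sum.inr (Sum.inl i))) ∧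
      coord ⁅x, y⁆ = Quotient.mk rel (fun i => p (Sum.inr (Sum.inr i)))}

variable {L M}

/-- The subset `S` of the definable Lie ring `g` is definable in `M`, with parameters. -/
def DefinableLieRing.DefinableSubset {g : Type*} [LieRing g] (P : DefinableLieRing L M g)
    (S : Set g) : Prop :=
  InterpretableSet L P.rel (P.coord '' S)

end LieRings

/-- The Fitting ideal of a Lie ring: the sum of all ideals that are nilpotent as Lie rings.
Ideals of a Lie ring are the Lie ideals over `ℤ`. -/
def fittingIdeal (g : Type*) [LieRing g] : LieIdeal ℤ g :=
  sSup {I : LieIdeal ℤ g | LieRing.IsNilpotent I}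

end Interp

/-! Sizes are measured up to finite index: `H.relIndex K ≠ 0` says that `H ⊓ K` has finite index in
`K`, so `N.relIndex W ≠ 0` says that `W` is finite modulo `N`.

Model theory enters only through `DefSystem`. Dimension gives definable subgroups a rank that drops
at infinite index (`exists_rank`), so no infinite descending chain has all its steps of infinite
index. In an ultrapower this bounds the finite indices occurring in a definable family
(`exists_relIndex_le`); hence the almost centralizer `act N D` is definable.

The algebra is an induction on `rk E - rk N` (`fitMod_inf`): for definable ideals `N ≤ E`, the ideal
`F = fitMod N ⊓ E` is definable and nilpotent modulo `N`. Let `Z` be the almost centre of `E` modulo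
`N`.

If `Z` is infinite modulo `N`, a Baer-Neumann argument gives definable ideals `Z' ≤ E₁`, with `E₁`
of finite index in `E`, `Z'` infinite modulo `N`, and `⁅E₁, ⁅E₁, Z'⁆⁆ ≤ N`. Induction applies to `Z'
≤ E₁`, and its result is nilpotent modulo `N` and of finite index in `F`. Fitting's theorem on sums
absorbs the finitely many remaining cosets.

If `Z` is finite modulo `N`, let `D` be a centralizer in `E` modulo `N` of a finite subset of `F`,
of minimal rank. Every element of `F` almost centralizes `D`, so `F` lies in the ideal `E' = act N D
⊓ E`. Either `E'` has infinite index in `E` and induction applies to it, or symmetry of almost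
centralization puts a finite-index part of `D` into `Z`. Then `D` is finite modulo `N`, which forces
`F ≤ Z`. -/

namespace Interp

/-! ### Finite index and separated families -/

section RelIndex

variable {G : Type*} [AddCommGroup G]

theorem relIndex_ne_zero_of_le_right {H K K' : AddSubgroup G} (h : K ≤ K')
    (hH : H.relIndex K' ≠ 0) : H.relIndex K ≠ 0 :=
  fun h0 => hH (AddSubgroup.relIndex_eq_zero_of_le_right h h0)

theorem relIndex_ne_zero_of_le_left {H H' K : AddSubgroup G} (h : H ≤ H')
    (hH : H.relIndex K ≠ 0) : H'.relIndex K ≠ 0 :=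
  fun h0 => hH (AddSubgroup.relIndex_eq_zero_of_le_left h h0)

/-- There are `m` elements of `K` which are pairwise distinct modulo `H`. -/
def HasSeparated (m : ℕ) (H K : AddSubgroup G) : Prop :=
  ∃ y : Fin m → G, (∀ i, y i ∈ K) ∧ Pairwise fun i j => y i - y j ∉ H

/-- Turns lower bounds on the index into an existential condition on elements; the index `0`,
meaning infinite, counts as larger than every `m`. -/
theorem hasSeparated_iff {m : ℕ} {H K : AddSubgroup G} :
    HasSeparated m H K ↔ H.relIndex K = 0 ∨ m ≤ H.relIndex K := by
  have key : HasSeparated m H K ↔ Nonempty (Fin m ↪ K ⧸ H.addSubgroupOf K) := by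
    constructor
    · rintro ⟨y, hy, hs⟩
      refine ⟨⟨fun i => QuotientAddGroup.mk ⟨y i, hy i⟩, fun i j hij => ?_⟩⟩
      by_contra hne
      have := (QuotientAddGroup.eq.1 hij)
      rw [AddSubgroup.mem_addSubgroupOf] at this
      refine hs (Ne.symm hne) ?_
      simpa [sub_eq_add_neg, add_comm] using this
    · rintro ⟨f⟩
      refine ⟨fun i => ((f i).out : K), fun i => ((f i).out : K).2, fun i j hij h => ?_⟩
      refine hij (f.injective ?_)
      rw [← (f i).out_eq', ← (f j).out_eq']
      refine (QuotientAddGroup.eq.2 ?_)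
      rw [AddSubgroup.mem_addSubgroupOf]
      have := H.neg_mem h
      simpa [sub_eq_add_neg, add_comm] using this
  rw [key, AddSubgroup.relIndex, AddSubgroup.index]
  constructor
  · rintro ⟨f⟩
    cases finite_or_infinite (K ⧸ H.addSubgroupOf K)
    · right
      simpa using Nat.card_le_card_of_injective f f.injective
    · left; exact Nat.card_eq_zero_of_infinite
  · rintro (h | h)
    · have hne : Nonempty (K ⧸ H.addSubgroupOf K) := ⟨0⟩
      rcases Nat.card_eq_zero.1 h with h | h
      · exact (not_isEmpty_of_nonempty _ h).elim
      · exact ⟨(Fin.valEmbedding).trans (Infinite.natEmbedding _)⟩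
    · rcases Nat.eq_zero_or_pos m with rfl | hm
      · exact ⟨Function.Embedding.ofIsEmpty⟩
      · have : Finite (K ⧸ H.addSubgroupOf K) := Nat.finite_of_card_ne_zero (by omega)
        have e := Finite.equivFin (K ⧸ H.addSubgroupOf K)
        exact ⟨(Fin.castLEEmb h).trans e.symm.toEmbedding⟩

theorem relIndex_eq_zero_iff {H K : AddSubgroup G} :
    H.relIndex K = 0 ↔ ∀ m, HasSeparated m H K := by
  simp only [hasSeparated_iff]
  refine ⟨fun h m => Or.inl h, fun h => ?_⟩
  rcases h (H.relIndex K + 1) with h | h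
  · exact h
  · omega

/-- A separated family of maximal length meets every coset, since a point outside all its cosets
would lengthen it. -/
theorem exists_finset_of_relIndex_ne_zero {H K : AddSubgroup G} (h : H.relIndex K ≠ 0) :
    ∃ t : Finset G, (∀ z ∈ t, z ∈ K) ∧ ∀ y ∈ K, ∃ z ∈ t, y - z ∈ H := by
  classical
  obtain ⟨y, hy, hs⟩ := hasSeparated_iff.2 (Or.inr (le_refl (H.relIndex K)))
  refine ⟨Finset.univ.image y, by simpa using hy, fun x hx => ?_⟩
  by_contra! hn
  have : HasSeparated (H.relIndex K + 1) H K := by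
    refine ⟨Fin.cons x y, fun i => ?_, fun i j hij => ?_⟩
    · refine Fin.cases hx hy i
    · induction i using Fin.cases with
      | zero => induction j using Fin.cases with
        | zero => exact (hij rfl).elim
        | succ j => exact hn _ (by simp)
      | succ i => induction j using Fin.cases with
        | zero =>
          intro hm
          refine hn (y i) (by simp) ?_
          have := H.neg_mem hm
          simpa using this
        | succ j =>
          simp only [Fin.cons_succ]
          exact hs (fun h => hij (by rw [h]))
  rcases hasSeparated_iff.1 this with h' | h'
  · exact h h'
  · omega

theorem relIndex_sup_ne_zero {N H K : AddSubgroup G} (hH : N.relIndex H ≠ 0)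
    (hK : N.relIndex K ≠ 0) : N.relIndex (H ⊔ K) ≠ 0 := by
  have h1 : N.relIndex (H ⊔ N) ≠ 0 := by rwa [AddSubgroup.relIndex_sup_right]
  have h2 : (H ⊔ N).relIndex (K ⊔ (H ⊔ N)) ≠ 0 := by
    rw [AddSubgroup.relIndex_sup_right]
    exact relIndex_ne_zero_of_le_left le_sup_right hK
  refine relIndex_ne_zero_of_le_right ?_ (AddSubgroup.relIndex_ne_zero_trans h1 h2)
  exact sup_le (le_sup_left.trans le_sup_right) le_sup_left

theorem relIndex_finset_sup_ne_zero {ι : Type*} {N : AddSubgroup G} (t : Finset ι)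
    (H : ι → AddSubgroup G) (h : ∀ i ∈ t, N.relIndex (H i) ≠ 0) :
    N.relIndex (t.sup H) ≠ 0 := by
  classical
  induction t using Finset.induction_on with
  | empty => simp
  | insert a t _ ih =>
    rw [Finset.sup_insert]
    exact relIndex_sup_ne_zero (h a (by simp)) (ih fun i hi => h i (by simp [hi]))

theorem relIndex_finset_inf_ne_zero {ι : Type*} {K : AddSubgroup G} (t : Finset ι)
    (H : ι → AddSubgroup G) (h : ∀ i ∈ t, (H i).relIndex K ≠ 0) :
    (t.inf H).relIndex K ≠ 0 := by
  classical
  induction t using Finset.induction_on with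
  | empty => simp
  | insert a t _ ih =>
    rw [Finset.inf_insert]
    exact AddSubgroup.relIndex_inf_ne_zero (h a (by simp)) (ih fun i hi => h i (by simp [hi]))

end RelIndex

/-! ### Almost centralizers and finiteness of commutators -/

section Centralizers

variable {g : Type*} [LieRing g]

/-- The additive endomorphism `y ↦ ⁅x, y⁆`. -/
def adHom (x : g) : g →+ g := AddMonoidHom.mk' (fun y => ⁅x, y⁆) (lie_add x)

@[simp] theorem adHom_apply (x y : g) : adHom x y = ⁅x, y⁆ := rfl

/-- The centralizer of `x` modulo `N`. -/
def ctr (N : AddSubgroup g) (x : g) : AddSubgroup g := N.comap (adHom x)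

@[simp] theorem mem_ctr {N : AddSubgroup g} {x y : g} : y ∈ ctr N x ↔ ⁅x, y⁆ ∈ N := Iff.rfl

theorem mem_ctr_comm {N : AddSubgroup g} {x y : g} : y ∈ ctr N x ↔ x ∈ ctr N y := by
  rw [mem_ctr, mem_ctr, ← lie_skew, neg_mem_iff]

/-- The almost centralizer of `D` modulo `N`. -/
def act (N D : AddSubgroup g) : AddSubgroup g where
  carrier := {x | (ctr N x).relIndex D ≠ 0}
  zero_mem' := by
    have : ctr N (0 : g) = ⊤ := by ext; simp [N.zero_mem]
    simp [this]
  add_mem' {x y} hx hy := by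
    refine relIndex_ne_zero_of_le_left ?_ (AddSubgroup.relIndex_inf_ne_zero hx hy)
    intro z hz
    rw [mem_ctr, add_lie]
    exact N.add_mem hz.1 hz.2
  neg_mem' {x} hx := by
    refine relIndex_ne_zero_of_le_left ?_ hx
    intro z hz
    rw [mem_ctr, neg_lie]
    exact N.neg_mem hz

theorem mem_act {N D : AddSubgroup g} {x : g} : x ∈ act N D ↔ (ctr N x).relIndex D ≠ 0 := Iff.rfl

/-- By B. H. Neumann's covering lemma. Among `k + 1` elements `y i` of `E`, each `x ∈ D` centralizes
some difference modulo `N`, so the centralizers of the differences cover `D` and one of them has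
finite index. That difference lies in `act N D`, so the `y i` are not separated. -/
theorem act_relIndex_ne_zero {N D E : AddSubgroup g} (k : ℕ)
    (h : ∀ x ∈ D, (ctr N x).relIndex E ≠ 0 ∧ (ctr N x).relIndex E ≤ k) :
    (act N D).relIndex E ≠ 0 := by
  classical
  intro h0
  obtain ⟨y, hy, hs⟩ := relIndex_eq_zero_iff.1 h0 (k + 1)
  have hcov : ∀ x ∈ D, ∃ i j, i ≠ j ∧ x ∈ ctr N (y i - y j) := by
    intro x hx
    by_contra! hn
    have : HasSeparated (k + 1) (ctr N x) E :=
      ⟨y, hy, fun i j hij hm => hn i j hij (mem_ctr_comm.1 hm)⟩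
    rcases hasSeparated_iff.1 this with h' | h'
    · exact (h x hx).1 h'
    · have := (h x hx).2; omega
  let s : Finset (Fin (k + 1) × Fin (k + 1)) := Finset.univ.filter fun p => p.1 ≠ p.2
  have := AddSubgroup.exists_finiteIndex_of_leftCoset_cover (G := D) (s := s)
    (H := fun p => (ctr N (y p.1 - y p.2)).addSubgroupOf D) (g := fun _ => 0) (by
      rw [Set.eq_univ_iff_forall]
      intro x
      obtain ⟨i, j, hij, hx⟩ := hcov x x.2
      simp only [Set.mem_iUnion]
      refine ⟨(i, j), by simp [s, hij], ?_⟩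
      exact Set.mem_vadd_set.2 ⟨x, hx, zero_add x⟩)
  obtain ⟨p, hp, hf⟩ := this
  exact hs (Finset.mem_filter.1 hp).2 (mem_act.2 hf.index_ne_zero)

/-- Take `a ∈ D` whose centralizer has maximal index in `E`, with coset representatives `y i`.
Adding to `a` an `x ∈ D` that centralizes all `y i` keeps them separated, so by maximality they
still represent all cosets for `a + x`. Comparison gives `⁅x, z⁆ ≡ ⁅a, y i⁆` modulo `N` when `z`
centralizes `a`: finite-index parts of `D` and `E` have brackets in `⁅a, E⁆ + N`, which is finite
modulo `N`. -/
theorem exists_relIndex_ne_zero_of_lie {N D E : AddSubgroup g} (k : ℕ)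
    (h : ∀ x ∈ D, (ctr N x).relIndex E ≠ 0 ∧ (ctr N x).relIndex E ≤ k)
    (h' : ∀ y ∈ E, (ctr N y).relIndex D ≠ 0) :
    ∃ W : AddSubgroup g, N ≤ W ∧ N.relIndex W ≠ 0 ∧ ∀ x ∈ D, ∀ y ∈ E, ⁅x, y⁆ ∈ W := by
  classical
  obtain ⟨a, ha, hmax⟩ : ∃ a ∈ D, ∀ x ∈ D, (ctr N x).relIndex E ≤ (ctr N a).relIndex E := by
    have hbdd : BddAbove ((fun x => (ctr N x).relIndex E) '' (D : Set g)) :=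
      ⟨k, by rintro _ ⟨x, hx, rfl⟩; exact (h x hx).2⟩
    have hne : ((fun x => (ctr N x).relIndex E) '' (D : Set g)).Nonempty :=
      ⟨_, 0, D.zero_mem, rfl⟩
    obtain ⟨a, ha, hae⟩ := Nat.sSup_mem hne hbdd
    exact ⟨a, ha, fun x hx => (le_csSup hbdd ⟨x, hx, rfl⟩).trans hae.ge⟩
  obtain ⟨t, htE, ht⟩ := exists_finset_of_relIndex_ne_zero (h a ha).1
  obtain ⟨y, hy, hs⟩ := hasSeparated_iff.2 (Or.inr (le_refl ((ctr N a).relIndex E)))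
  let A : AddSubgroup g := Finset.univ.inf fun i => ctr N (y i)
  have hA : A.relIndex D ≠ 0 := relIndex_finset_inf_ne_zero _ _ fun i _ => h' _ (hy i)
  have memA : ∀ x, x ∈ A → ∀ i, ⁅y i, x⁆ ∈ N := by
    intro x hx i
    exact (Finset.inf_le (f := fun i => ctr N (y i)) (Finset.mem_univ i)) hx
  have key : ∀ x ∈ A ⊓ D, ∀ z ∈ ctr N a ⊓ E, ⁅x, z⁆ ∈ E.map (adHom a) ⊔ N := by
    rintro x ⟨hxA, hxD⟩ z ⟨hza, hzE⟩
    have hax : a + x ∈ D := D.add_mem ha hxD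
    have hex : ∃ i, z - y i ∈ ctr N (a + x) := by
      by_contra! hn
      have : HasSeparated ((ctr N a).relIndex E + 1) (ctr N (a + x)) E := by
        have hyy : ∀ i j, i ≠ j → y i - y j ∉ ctr N (a + x) := by
          intro i j hij hm
          refine hs hij ?_
          rw [mem_ctr, add_lie] at hm
          have h1 : ⁅x, y i - y j⁆ ∈ N := by
            rw [lie_sub]
            refine N.sub_mem ?_ ?_ <;> rw [← lie_skew, neg_mem_iff] <;> exact memA x hxA _
          simpa using N.sub_mem hm h1
        refine ⟨Fin.cons z y, fun i => ?_, fun i j hij => ?_⟩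
        · exact Fin.cases hzE hy i
        · induction i using Fin.cases with
          | zero => induction j using Fin.cases with
            | zero => exact (hij rfl).elim
            | succ j => exact hn j
          | succ i => induction j using Fin.cases with
            | zero =>
              intro hm
              refine hn i ?_
              have := AddSubgroup.neg_mem _ hm
              simpa using this
            | succ j => exact hyy i j fun e => hij (by rw [e])
      rcases hasSeparated_iff.1 this with h0 | h0
      · exact (h _ hax).1 h0
      · have := hmax _ hax; omega
    obtain ⟨i, hi⟩ := hex
    rw [mem_ctr, add_lie, lie_sub, lie_sub] at hi
    have h1 : ⁅x, y i⁆ ∈ N := by rw [← lie_skew, neg_mem_iff]; exact memA x hxA i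
    have h2 : ⁅x, z⁆ = ⁅a, y i⁆ +
        ((⁅a, z⁆ - ⁅a, y i⁆ + (⁅x, z⁆ - ⁅x, y i⁆)) - ⁅a, z⁆ + ⁅x, y i⁆) := by abel
    rw [h2]
    refine AddSubgroup.add_mem_sup ⟨y i, hy i, rfl⟩ ?_
    exact N.add_mem (N.sub_mem hi hza) h1
  obtain ⟨s, hsD, hsA⟩ := exists_finset_of_relIndex_ne_zero hA
  -- The representatives `s` of `D` modulo `A` and `t` of `E` modulo `ctr N a` each contribute one
  -- more image that is finite modulo `N`.
  refine ⟨(E.map (adHom a) ⊔ N) ⊔ (s.sup (fun z => E.map (adHom z)) ⊔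
    t.sup fun z => D.map (adHom z)), le_sup_right.trans le_sup_left, ?_, ?_⟩
  · refine relIndex_sup_ne_zero (relIndex_sup_ne_zero ?_ ?_) (relIndex_sup_ne_zero ?_ ?_)
    · rw [← AddSubgroup.relIndex_comap]; exact (h a ha).1
    · simp
    · refine relIndex_finset_sup_ne_zero _ _ fun z hz => ?_
      rw [← AddSubgroup.relIndex_comap]; exact (h z (hsD z hz)).1
    · refine relIndex_finset_sup_ne_zero _ _ fun z hz => ?_
      rw [← AddSubgroup.relIndex_comap]; exact h' z (htE z hz)
  · intro x hx z hz
    obtain ⟨x', hx', hxx⟩ := hsA x hx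
    obtain ⟨z', hz', hzz⟩ := ht z hz
    have e : ⁅x, z⁆ = ⁅x - x', z - z'⁆ + (⁅x', z⁆ + ⁅z', -(x - x')⁆) := by
      rw [lie_neg, lie_skew]
      simp only [lie_sub, sub_lie]; abel
    rw [e]
    refine AddSubgroup.add_mem_sup (key _ ⟨hxx, D.sub_mem hx (hsD _ hx')⟩ _
      ⟨hzz, E.sub_mem hz (htE _ hz')⟩) (AddSubgroup.add_mem_sup ?_ ?_)
    · exact (Finset.le_sup (f := fun z => E.map (adHom z)) hx') ⟨z, hz, rfl⟩
    · exact (Finset.le_sup (f := fun z => D.map (adHom z)) hz')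
        ⟨_, D.neg_mem (D.sub_mem hx (hsD _ hx')), rfl⟩

end Centralizers

end Interp

namespace Interp

/-! ### Fitting's theorem, relative to an ideal -/

section Nilpotency

variable {g : Type*} [LieRing g]

/-- The additive group of an ideal. -/
def ag (I : LieIdeal ℤ g) : AddSubgroup g := I.toSubmodule.toAddSubgroup

@[simp] theorem mem_ag {I : LieIdeal ℤ g} {x : g} : x ∈ ag I ↔ x ∈ I := Iff.rfl

@[simp] theorem ag_inf (I J : LieIdeal ℤ g) : ag (I ⊓ J) = ag I ⊓ ag J := rfl

theorem ag_sup (I J : LieIdeal ℤ g) : ag (I ⊔ J) = ag I ⊔ ag J := by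
  ext x
  rw [mem_ag, LieSubmodule.mem_sup, AddSubgroup.mem_sup]
  rfl

/-- The ideal with a given additive group. -/
def idealOf (H : AddSubgroup g) (h : ∀ z : g, ∀ x ∈ H, ⁅z, x⁆ ∈ H) : LieIdeal ℤ g where
  toSubmodule := AddSubgroup.toIntSubmodule H
  lie_mem {z x} hx := h z x hx

/-- The ideal `I` is nilpotent modulo the ideal `N`. -/
def NilMod (N I : LieIdeal ℤ g) : Prop := ∃ k, I.lcs g k ≤ N

theorem lcs_mono {I J : LieIdeal ℤ g} (h : I ≤ J) (k : ℕ) : I.lcs g k ≤ J.lcs g k := by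
  induction k with
  | zero => simp
  | succ k ih =>
    rw [LieIdeal.lcs_succ, LieIdeal.lcs_succ]
    exact LieSubmodule.mono_lie h ih

theorem NilMod.mono {N N' I J : LieIdeal ℤ g} (hN : N ≤ N') (hI : J ≤ I) (h : NilMod N I) :
    NilMod N' J := by
  obtain ⟨k, hk⟩ := h
  exact ⟨k, (lcs_mono hI k).trans (hk.trans hN)⟩

/-- The series `I.lcs g` starts at the whole ring, so one step is needed to enter `I`. -/
theorem nilMod_of_le {N I : LieIdeal ℤ g} (h : I ≤ N) : NilMod N I :=
  ⟨1, by
    rw [LieIdeal.lcs_succ]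
    exact (LieSubmodule.lie_le_left _ _).trans h⟩

theorem antitone_lcs (I : LieIdeal ℤ g) : Antitone (I.lcs g) := by
  refine antitone_nat_of_succ_le fun k => ?_
  rw [LieIdeal.lcs_succ]
  exact LieSubmodule.lie_le_right _ _

theorem lie_finset_sup {ι : Type*} (I : LieIdeal ℤ g) (s : Finset ι) (J : ι → LieIdeal ℤ g) :
    ⁅I, s.sup J⁆ = s.sup fun i => ⁅I, J i⁆ :=
  Finset.apply_sup_eq_sup_comp (fun X : LieIdeal ℤ g => ⁅I, X⁆)
    (fun X Y => LieSubmodule.lie_sup X Y I) (LieSubmodule.lie_bot I)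

/-- Each further bracket with `I` or with `J` advances one of the two series and stays in the
current term of the other, which is an ideal. -/
theorem lcs_sup_le (I J : LieIdeal ℤ g) (m : ℕ) :
    (I ⊔ J).lcs g m ≤
      (Finset.HasAntidiagonal.antidiagonal m).sup fun p => I.lcs g p.1 ⊓ J.lcs g p.2 := by
  induction m with
  | zero => simp
  | succ m ih =>
    rw [LieIdeal.lcs_succ]
    refine (LieSubmodule.mono_lie le_rfl ih).trans ?_
    rw [lie_finset_sup]
    refine Finset.sup_le fun p hp => ?_
    rw [Finset.HasAntidiagonal.mem_antidiagonal] at hp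
    rw [LieSubmodule.sup_lie]
    refine sup_le ?_ ?_
    · have hm : (p.1 + 1, p.2) ∈ Finset.HasAntidiagonal.antidiagonal (m + 1) := by
        rw [Finset.HasAntidiagonal.mem_antidiagonal]
        simp only
        omega
      refine le_trans (le_inf ?_ ?_)
        (Finset.le_sup (f := fun p : ℕ × ℕ => I.lcs g p.1 ⊓ J.lcs g p.2) hm)
      · rw [LieIdeal.lcs_succ]
        exact LieSubmodule.mono_lie le_rfl inf_le_left
      · exact (LieSubmodule.lie_le_right _ _).trans inf_le_right
    · have hm : (p.1, p.2 + 1) ∈ Finset.HasAntidiagonal.antidiagonal (m + 1) := by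
        rw [Finset.HasAntidiagonal.mem_antidiagonal]
        simp only
        omega
      refine le_trans (le_inf ?_ ?_)
        (Finset.le_sup (f := fun p : ℕ × ℕ => I.lcs g p.1 ⊓ J.lcs g p.2) hm)
      · exact (LieSubmodule.lie_le_right _ _).trans inf_le_left
      · rw [LieIdeal.lcs_succ]
        exact LieSubmodule.mono_lie le_rfl inf_le_right

theorem NilMod.sup {N I J : LieIdeal ℤ g} (hI : NilMod N I) (hJ : NilMod N J) :
    NilMod N (I ⊔ J) := by
  obtain ⟨a, ha⟩ := hI
  obtain ⟨b, hb⟩ := hJ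
  refine ⟨a + b, (lcs_sup_le I J _).trans (Finset.sup_le fun p hp => ?_)⟩
  rw [Finset.HasAntidiagonal.mem_antidiagonal] at hp
  rcases le_total a p.1 with h | h
  · exact inf_le_left.trans ((antitone_lcs I h).trans ha)
  · exact inf_le_right.trans ((antitone_lcs J (by omega)).trans hb)

/-- The sum of all ideals that are nilpotent modulo `N`. -/
def fitMod (N : LieIdeal ℤ g) : LieIdeal ℤ g := sSup {I | NilMod N I}

theorem mem_fitMod {N : LieIdeal ℤ g} {x : g} : x ∈ fitMod N ↔ ∃ I, NilMod N I ∧ x ∈ I := by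
  constructor
  · intro hx
    have hd : DirectedOn (· ≤ ·) {I : LieIdeal ℤ g | NilMod N I} := fun I hI J hJ =>
      ⟨I ⊔ J, hI.sup hJ, le_sup_left, le_sup_right⟩
    have hne : {I : LieIdeal ℤ g | NilMod N I}.Nonempty := ⟨N, nilMod_of_le le_rfl⟩
    let U : LieIdeal ℤ g := idealOf
      { carrier := {y | ∃ I, NilMod N I ∧ y ∈ I}
        zero_mem' := ⟨N, nilMod_of_le le_rfl, N.zero_mem⟩
        add_mem' := by
          rintro y z ⟨I, hI, hy⟩ ⟨J, hJ, hz⟩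
          exact ⟨I ⊔ J, hI.sup hJ, add_mem (le_sup_left (a := I) hy) (le_sup_right (a := I) hz)⟩
        neg_mem' := by
          rintro y ⟨I, hI, hy⟩
          exact ⟨I, hI, neg_mem hy⟩ } (by
        rintro z y ⟨I, hI, hy⟩
        exact ⟨I, hI, I.lie_mem hy⟩)
    have : fitMod N ≤ U := sSup_le fun I hI y hy => ⟨I, hI, hy⟩
    exact this hx
  · rintro ⟨I, hI, hx⟩
    exact (le_sSup (a := I) hI) hx

theorem NilMod.le_fitMod {N I : LieIdeal ℤ g} (h : NilMod N I) : I ≤ fitMod N := le_sSup h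

theorem fitMod_mono {N N' : LieIdeal ℤ g} (h : N ≤ N') : fitMod N ≤ fitMod N' :=
  sSup_le_sSup fun _ hI => hI.mono h le_rfl

theorem exists_nilMod_of_finset {N : LieIdeal ℤ g} (t : Finset g) (ht : ∀ x ∈ t, x ∈ fitMod N) :
    ∃ I, NilMod N I ∧ ∀ x ∈ t, x ∈ I := by
  classical
  induction t using Finset.induction_on with
  | empty => exact ⟨N, nilMod_of_le le_rfl, by simp⟩
  | insert a t _ ih =>
    obtain ⟨I, hI, h⟩ := ih fun x hx => ht x (by simp [hx])
    obtain ⟨J, hJ, h'⟩ := mem_fitMod.1 (ht a (by simp))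
    refine ⟨I ⊔ J, hI.sup hJ, fun x hx => ?_⟩
    rcases Finset.mem_insert.1 hx with rfl | hx
    · exact (le_sup_right (a := I)) h'
    · exact (le_sup_left (b := J)) (h x hx)

/-- Representatives of the finitely many cosets lie in one ideal nilpotent modulo `N`; its sum with
`K` contains `F`. -/
theorem NilMod.of_relIndex_ne_zero {N K F : LieIdeal ℤ g} (hK : NilMod N K) (hF : F ≤ fitMod N)
    (h : (ag K).relIndex (ag F) ≠ 0) : NilMod N F := by
  obtain ⟨t, htF, ht⟩ := exists_finset_of_relIndex_ne_zero h
  obtain ⟨I, hI, htI⟩ := exists_nilMod_of_finset t fun x hx => hF (htF x hx)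
  refine (hK.sup hI).mono le_rfl fun x hx => ?_
  obtain ⟨z, hz, hxz⟩ := ht x hx
  have := add_mem ((le_sup_left (b := I)) hxz) ((le_sup_right (a := K)) (htI z hz))
  simpa using this

/-- The shift by one occurs because one series starts at `g` and the other at `I`. -/
theorem mem_lowerCentralSeries_of_mem_lcs (I : LieIdeal ℤ g) (k : ℕ) :
    ∀ x ∈ I.lcs g (k + 1), ∃ h : x ∈ I, (⟨x, h⟩ : I) ∈ LieModule.lowerCentralSeries ℤ I I k := by
  induction k with
  | zero =>
    intro x hx
    rw [LieIdeal.lcs_succ] at hx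
    exact ⟨LieSubmodule.lie_le_left _ _ hx, by simp⟩
  | succ k ih =>
    intro x hx
    rw [LieIdeal.lcs_succ, ← LieSubmodule.mem_toSubmodule,
      LieSubmodule.lieIdeal_oper_eq_linear_span'] at hx
    induction hx using Submodule.span_induction with
    | mem x hx =>
      obtain ⟨a, ha, y, hy, rfl⟩ := hx
      obtain ⟨hyI, hy'⟩ := ih y hy
      refine ⟨I.lie_mem hyI, ?_⟩
      rw [LieModule.lowerCentralSeries_succ]
      exact LieSubmodule.lie_mem_lie (LieSubmodule.mem_top (⟨a, ha⟩ : I)) hy'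
    | zero => exact ⟨I.zero_mem, zero_mem _⟩
    | add x y _ _ hx hy =>
      obtain ⟨hxI, hx⟩ := hx
      obtain ⟨hyI, hy⟩ := hy
      exact ⟨I.add_mem hxI hyI, add_mem hx hy⟩
    | smul n x _ hx =>
      obtain ⟨hxI, hx⟩ := hx
      exact ⟨I.smul_mem n hxI, (LieModule.lowerCentralSeries ℤ I I (k + 1)).smul_mem n hx⟩

theorem isNilpotent_iff_nilMod_bot {I : LieIdeal ℤ g} : LieRing.IsNilpotent I ↔ NilMod ⊥ I := by
  constructor
  · intro h
    obtain ⟨k, hk⟩ := h.nilpotent_int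
    refine ⟨k + 1, fun x hx => ?_⟩
    obtain ⟨hI, hx'⟩ := mem_lowerCentralSeries_of_mem_lcs I k x hx
    rw [hk, LieSubmodule.mem_bot] at hx'
    simpa using congrArg Subtype.val hx'
  · rintro ⟨k, hk⟩
    have : LieModule.IsNilpotent I g := by
      refine ⟨k, ?_⟩
      rw [← LieSubmodule.toSubmodule_inj, ← LieIdeal.coe_lcs_eq, le_bot_iff.1 hk]
      rfl
    refine Function.Injective.lieModuleIsNilpotent (R := ℤ) (L := I) (L₂ := I) (M := I) (M₂ := g)
      (f := LieHom.id) (g := I.toSubmodule.subtype) (fun _ _ => rfl)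
      Subtype.val_injective

theorem fittingIdeal_eq_fitMod_bot : fittingIdeal g = fitMod ⊥ := by
  simp only [fittingIdeal, fitMod, isNilpotent_iff_nilMod_bot]

end Nilpotency

end Interp

/-! ### Ranked systems of definable subgroups; ideals from almost centralizers -/

namespace Interp

/-- A class of "definable" additive subgroups of a Lie ring with a rank that drops
at subgroups of infinite index. -/
structure DefSystem (g : Type*) [LieRing g] where
  /-- The definable additive subgroups. -/
  Def : AddSubgroup g → Prop
  /-- The rank. -/
  rk : AddSubgroup g → ℕ
  bot : Def ⊥
  top : Def ⊤
  inf {H K : AddSubgroup g} : Def H → Def K → Def (H ⊓ K)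
  of_relIndex_ne_zero {H K : AddSubgroup g} : Def H → H ≤ K → H.relIndex K ≠ 0 → Def K
  ctr {N : AddSubgroup g} (x : g) : Def N → Def (ctr N x)
  act {N D : AddSubgroup g} : Def N → Def D → Def (act N D)
  bounded {N D : AddSubgroup g} : Def N → Def D →
    ∃ k, ∀ x, (Interp.ctr N x).relIndex D ≠ 0 → (Interp.ctr N x).relIndex D ≤ k
  rk_mono {H K : AddSubgroup g} : Def H → Def K → H ≤ K → rk H ≤ rk K
  rk_lt {H K : AddSubgroup g} : Def H → Def K → H ≤ K → H.relIndex K = 0 → rk H < rk K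

section AlmostIdeals

variable {g : Type*} [LieRing g]

/-- By the Jacobi identity, `⁅⁅z, x⁆, y⁆ ∈ N` as soon as `x` centralizes `y` and `⁅z, y⁆` modulo
`N`. Invariance of `D` under `z` up to finite index is enough for this, and is all that the minimal
centralizer in `fitMod_inf` satisfies. -/
theorem lie_mem_act {N D : AddSubgroup g} (hN : ∀ z : g, ∀ x ∈ N, ⁅z, x⁆ ∈ N) {z : g}
    (hD : (D.comap (adHom z)).relIndex D ≠ 0) {x : g} (hx : x ∈ act N D) : ⁅z, x⁆ ∈ act N D := by
  rw [mem_act] at hx ⊢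
  have h1 : ((ctr N x).comap (adHom z)).relIndex (D ⊓ D.comap (adHom z)) ≠ 0 := by
    rw [AddSubgroup.relIndex_comap]
    refine relIndex_ne_zero_of_le_right ?_ hx
    rintro _ ⟨y, hy, rfl⟩
    exact hy.2
  have h2 : ((ctr N x).comap (adHom z)).relIndex D ≠ 0 := by
    have h3 := AddSubgroup.relIndex_ne_zero_trans h1 (by rwa [AddSubgroup.inf_relIndex_left])
    exact h3
  refine relIndex_ne_zero_of_le_left ?_ (AddSubgroup.relIndex_inf_ne_zero hx h2)
  rintro y ⟨hy1, hy2⟩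
  rw [mem_ctr, lie_lie]
  exact N.sub_mem (hN _ _ hy1) hy2

theorem lie_mem_act_ag {N D : LieIdeal ℤ g} {z x : g} (hx : x ∈ act (ag N) (ag D)) :
    ⁅z, x⁆ ∈ act (ag N) (ag D) := by
  refine lie_mem_act (fun z x hx => N.lie_mem hx) ?_ hx
  have : ag D ≤ (ag D).comap (adHom z) := fun y hy => D.lie_mem hy
  rw [AddSubgroup.relIndex_eq_one.2 this]
  exact one_ne_zero

theorem ctr_eq_top {N : LieIdeal ℤ g} {x : g} (hx : x ∈ N) : ctr (ag N) x = ⊤ := by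
  refine eq_top_iff.2 fun y _ => ?_
  rw [mem_ctr_comm]
  exact N.lie_mem hx

theorem ag_le_act (N : LieIdeal ℤ g) (D : AddSubgroup g) : ag N ≤ act (ag N) D := fun x hx => by
  rw [mem_act, ctr_eq_top hx]; simp

end AlmostIdeals

/-! ### The induction for the Fitting ideal -/

namespace DefSystem

variable {g : Type*} [LieRing g] (S : DefSystem g)

theorem finset_inf {ι : Type*} (t : Finset ι) (H : ι → AddSubgroup g)
    (h : ∀ i ∈ t, S.Def (H i)) : S.Def (t.inf H) := by
  classical
  induction t using Finset.induction_on with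
  | empty => exact S.top
  | insert a t _ ih =>
    rw [Finset.inf_insert]
    exact S.inf (h a (by simp)) (ih fun i hi => h i (by simp [hi]))

/-- The almost centre of `E` modulo `N`, as an ideal. -/
def almostCenter (N E : LieIdeal ℤ g) : LieIdeal ℤ g :=
  idealOf (Interp.act (ag N) (ag E)) (fun _ _ hx => lie_mem_act_ag hx) ⊓ E

theorem def_almostCenter {N E : LieIdeal ℤ g} (hN : S.Def (ag N)) (hE : S.Def (ag E)) :
    S.Def (ag (almostCenter N E)) := S.inf (S.act hN hE) hE

/-- Let `E₀` be the part of `E` that almost centralizes the almost centre. By symmetry it has finite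
index in `E`, and `exists_relIndex_ne_zero_of_lie` applies to the two. -/
theorem exists_finite_commutator {N E : LieIdeal ℤ g} (hNE : N ≤ E) (hN : S.Def (ag N))
    (hE : S.Def (ag E)) :
    ∃ E₀ : LieIdeal ℤ g, S.Def (ag E₀) ∧ N ≤ E₀ ∧ E₀ ≤ E ∧ (ag E₀).relIndex (ag E) ≠ 0 ∧
      (ag N).relIndex (ag (N ⊔ ⁅almostCenter N E, E₀⁆)) ≠ 0 := by
  set Z := almostCenter N E
  have hZd : S.Def (ag Z) := S.def_almostCenter hN hE
  have hZact : ∀ z ∈ Z, (Interp.ctr (ag N) z).relIndex (ag E) ≠ 0 := fun z hz => hz.1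
  obtain ⟨k, hk⟩ := S.bounded hN hE
  have h0 : (Interp.act (ag N) (ag Z)).relIndex (ag E) ≠ 0 :=
    act_relIndex_ne_zero k fun x hx => ⟨hZact x hx, hk x (hZact x hx)⟩
  let E₀ : LieIdeal ℤ g := idealOf (Interp.act (ag N) (ag Z)) (fun _ _ hx => lie_mem_act_ag hx) ⊓ E
  have hE₀ : ag E₀ = Interp.act (ag N) (ag Z) ⊓ ag E := rfl
  have hE₀E : E₀ ≤ E := inf_le_right
  obtain ⟨W, hNW, hWi, hW⟩ := exists_relIndex_ne_zero_of_lie (N := ag N) (D := ag Z) (E := ag E₀) k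
    (fun x hx => by
      have h1 := hZact x hx
      exact ⟨relIndex_ne_zero_of_le_right hE₀E h1,
        (AddSubgroup.relIndex_le_of_le_right hE₀E h1).trans (hk x h1)⟩)
    (fun y hy => hy.1)
  refine ⟨E₀, S.inf (S.act hN hZd) hE, le_inf (ag_le_act N _) hNE, hE₀E,
    by rwa [hE₀, AddSubgroup.inf_relIndex_right], relIndex_ne_zero_of_le_right ?_ hWi⟩
  rw [ag_sup]
  refine sup_le hNW fun x hx => ?_
  rw [mem_ag, ← LieSubmodule.mem_toSubmodule, LieSubmodule.lieIdeal_oper_eq_linear_span'] at hx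
  induction hx using Submodule.span_induction with
  | mem x hx =>
    obtain ⟨a, ha, y, hy, rfl⟩ := hx
    exact hW a ha y hy
  | zero => exact W.zero_mem
  | add x y _ _ hx hy => exact W.add_mem hx hy
  | smul n x _ hx => exact W.zsmul_mem hx n

/-- The centralizer of `V` modulo `N`. -/
def centralizerMod (N V : LieIdeal ℤ g) : LieIdeal ℤ g :=
  idealOf
    { carrier := {x | ∀ w ∈ V, ⁅w, x⁆ ∈ N}
      zero_mem' := fun w _ => by rw [lie_zero]; exact N.zero_mem
      add_mem' := fun hx hy w hw => by rw [lie_add]; exact N.add_mem (hx w hw) (hy w hw)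
      neg_mem' := fun hx w hw => by rw [lie_neg]; exact neg_mem (hx w hw) }
    (by
      intro z x hx w hw
      rw [leibniz_lie]
      refine add_mem (hx _ ?_) (N.lie_mem (hx w hw))
      rw [← lie_skew]
      exact neg_mem (V.lie_mem hw))

/-- As `N` is an ideal, it suffices to centralize representatives of `V` modulo `N`; so the
centralizer is a finite intersection, hence definable if `N` is. -/
theorem exists_ag_centralizerMod_eq {N V : LieIdeal ℤ g} (h : (ag N).relIndex (ag V) ≠ 0) :
    ∃ t : Finset g, (∀ x ∈ t, x ∈ V) ∧
      ag (centralizerMod N V) = t.inf fun w => Interp.ctr (ag N) w := by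
  obtain ⟨t, htV, ht⟩ := exists_finset_of_relIndex_ne_zero h
  refine ⟨t, htV, le_antisymm (Finset.le_inf fun w hw x hx => hx w (htV w hw)) ?_⟩
  intro x hx w hw
  obtain ⟨z, hz, hwz⟩ := ht w hw
  have h1 : ⁅z, x⁆ ∈ N := (Finset.inf_le (f := fun w => Interp.ctr (ag N) w) hz) hx
  have h2 : x ∈ Interp.ctr (ag N) (w - z) := by rw [ctr_eq_top hwz]; trivial
  have := add_mem (show ⁅w - z, x⁆ ∈ N from h2) h1
  rwa [← add_lie, sub_add_cancel] at this

/-- The ideal `V = N ⊔ ⁅Z, E₀⁆` is finite modulo `N` and lies in the almost centre `Z`, so its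
centralizer has finite index in `E`. Intersecting `E₀` and `Z` with it yields `⁅E₁, Z'⁆ ≤ V` and
`⁅E₁, V⁆ ≤ N`. -/
theorem exists_central_section {N E : LieIdeal ℤ g} (hNE : N ≤ E) (hN : S.Def (ag N))
    (hE : S.Def (ag E)) (hZ : (ag N).relIndex (ag (almostCenter N E)) = 0) :
    ∃ E₁ Z' : LieIdeal ℤ g, S.Def (ag E₁) ∧ S.Def (ag Z') ∧ N ≤ Z' ∧ Z' ≤ E₁ ∧ E₁ ≤ E ∧
      (ag E₁).relIndex (ag E) ≠ 0 ∧ (ag N).relIndex (ag Z') = 0 ∧ ⁅E₁, ⁅E₁, Z'⁆⁆ ≤ N := by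
  obtain ⟨E₀, hE₀d, hNE₀, hE₀E, hE₀i, hVi⟩ := S.exists_finite_commutator hNE hN hE
  have hZd : S.Def (ag (almostCenter N E)) := S.def_almostCenter hN hE
  have hZE : almostCenter N E ≤ E := inf_le_right
  have hZact : ∀ z ∈ almostCenter N E, (Interp.ctr (ag N) z).relIndex (ag E) ≠ 0 :=
    fun z hz => hz.1
  have hNZ : N ≤ almostCenter N E := le_inf (ag_le_act N _) hNE
  generalize almostCenter N E = Z at *
  have hVZ : N ⊔ ⁅Z, E₀⁆ ≤ Z := sup_le hNZ (LieSubmodule.lie_le_left _ _)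
  have hEV : ⁅E₀, Z⁆ ≤ N ⊔ ⁅Z, E₀⁆ := by
    rw [LieSubmodule.lie_comm]
    exact le_sup_right
  generalize N ⊔ ⁅Z, E₀⁆ = V at *
  obtain ⟨t, htV, ht⟩ := exists_ag_centralizerMod_eq hVi
  have hA : ∀ x, x ∈ centralizerMod N V ↔ ∀ w ∈ V, ⁅w, x⁆ ∈ N := fun _ => Iff.rfl
  generalize centralizerMod N V = A at *
  have hE₁d : S.Def (ag (A ⊓ E₀)) := by
    rw [ag_inf, ht]
    exact S.inf (S.finset_inf _ _ fun w _ => S.ctr w hN) hE₀d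
  have hE₁i : (ag (A ⊓ E₀)).relIndex (ag E) ≠ 0 := by
    rw [ag_inf, ht]
    exact AddSubgroup.relIndex_inf_ne_zero
      (relIndex_finset_inf_ne_zero _ _ fun w hw => hZact w (hVZ (htV w hw))) hE₀i
  have hNE₁ : N ≤ A ⊓ E₀ := le_inf (fun x hx => (hA x).2 fun w _ => N.lie_mem hx) hNE₀
  have hZ'i : (ag (Z ⊓ (A ⊓ E₀))).relIndex (ag Z) ≠ 0 := by
    rw [ag_inf, AddSubgroup.inf_relIndex_left]
    exact relIndex_ne_zero_of_le_right hZE hE₁i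
  refine ⟨A ⊓ E₀, Z ⊓ (A ⊓ E₀), hE₁d, S.inf hZd hE₁d, le_inf hNZ hNE₁, inf_le_right,
    inf_le_right.trans hE₀E, hE₁i, ?_, ?_⟩
  · by_contra h
    exact AddSubgroup.relIndex_ne_zero_trans h hZ'i hZ
  · have h1 : ⁅A ⊓ E₀, Z ⊓ (A ⊓ E₀)⁆ ≤ V :=
      (LieSubmodule.mono_lie inf_le_right inf_le_left).trans hEV
    refine (LieSubmodule.mono_lie inf_le_left h1).trans ?_
    rw [LieSubmodule.lieIdeal_oper_eq_span, LieSubmodule.lieSpan_le]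
    rintro _ ⟨x, y, rfl⟩
    have := (hA x).1 x.2 y y.2
    rw [← lie_skew]
    exact neg_mem this

/-- Climb the series of `I` from the bottom. Bracketing with `x ∈ t` sends each term into the next
one, finite modulo `N`; so the centralizer of `t` has finite index in the term, and this centralizer
is finite modulo `N` within `E`. -/
theorem relIndex_ne_zero_of_nilMod {N E I : LieIdeal ℤ g} {t : Finset g} (htI : ∀ x ∈ t, x ∈ I)
    (hIE : I ≤ E) (hI : NilMod N I)
    (hD : (ag N).relIndex (ag E ⊓ t.inf fun x => Interp.ctr (ag N) x) ≠ 0) :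
    (ag N).relIndex (ag I) ≠ 0 := by
  obtain ⟨c, hc⟩ := hI
  have key : ∀ j, j ≤ c → (ag N).relIndex (ag (I ⊓ I.lcs g (c - j))) ≠ 0 := by
    intro j
    induction j with
    | zero =>
      intro _
      have : ag (I ⊓ I.lcs g (c - 0)) ≤ ag N := inf_le_right.trans hc
      rw [AddSubgroup.relIndex_eq_one.2 this]
      exact one_ne_zero
    | succ j ih =>
      intro hj
      set J := I ⊓ I.lcs g (c - (j + 1))
      have hstep : ⁅I, J⁆ ≤ I ⊓ I.lcs g (c - j) := by
        refine le_inf (LieSubmodule.lie_le_left _ _) ?_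
        rw [show c - j = (c - (j + 1)) + 1 by omega, LieIdeal.lcs_succ]
        exact LieSubmodule.mono_lie le_rfl inf_le_right
      have h1 : (t.inf fun x => Interp.ctr (ag N) x).relIndex (ag J) ≠ 0 := by
        refine relIndex_finset_inf_ne_zero _ _ fun x hx => ?_
        rw [Interp.ctr, AddSubgroup.relIndex_comap]
        refine relIndex_ne_zero_of_le_right ?_ (ih (by omega))
        rintro _ ⟨y, hy, rfl⟩
        exact hstep (LieSubmodule.lie_mem_lie (htI x hx) hy)
      have h2 : (ag E ⊓ t.inf fun x => Interp.ctr (ag N) x).relIndex (ag J) ≠ 0 := by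
        refine AddSubgroup.relIndex_inf_ne_zero ?_ h1
        have : ag J ≤ ag E := inf_le_left.trans hIE
        rw [AddSubgroup.relIndex_eq_one.2 this]
        exact one_ne_zero
      rw [← AddSubgroup.inf_relIndex_right] at h2
      exact AddSubgroup.relIndex_ne_zero_trans (relIndex_ne_zero_of_le_right inf_le_left hD) h2
  have := key c le_rfl
  simpa using this

/-- Choose `t` with centralizer of least rank: enlarging `t` by `x` cannot lower the rank, so the
index stays finite. -/
theorem exists_minimal_centralizer {N E : LieIdeal ℤ g} (hN : S.Def (ag N)) (hE : S.Def (ag E))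
    (F : LieIdeal ℤ g) : ∃ t : Finset g, (∀ x ∈ t, x ∈ F) ∧ ∀ x ∈ F,
      (Interp.ctr (ag N) x).relIndex (ag E ⊓ t.inf fun x => Interp.ctr (ag N) x) ≠ 0 := by
  classical
  let D : Finset g → AddSubgroup g := fun t => ag E ⊓ t.inf fun x => Interp.ctr (ag N) x
  have hD : ∀ t, S.Def (D t) := fun t => S.inf hE (S.finset_inf _ _ fun x _ => S.ctr x hN)
  let P : ℕ → Prop := fun r => ∃ t : Finset g, (∀ x ∈ t, x ∈ F) ∧ S.rk (D t) = r
  have hP : ∃ r, P r := ⟨_, ∅, by simp, rfl⟩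
  obtain ⟨t, htF, ht⟩ := Nat.find_spec hP
  refine ⟨t, htF, fun x hx h0 => ?_⟩
  have hins : D (insert x t) = D t ⊓ Interp.ctr (ag N) x := by
    simp only [D, Finset.inf_insert]
    ac_rfl
  have h1 : S.rk (D (insert x t)) < S.rk (D t) := by
    refine S.rk_lt (hD _) (hD _) (hins ▸ inf_le_left) ?_
    rw [hins, AddSubgroup.inf_relIndex_left]
    exact h0
  rw [ht] at h1
  refine Nat.find_min hP h1 ⟨_, fun y hy => ?_, rfl⟩
  rcases Finset.mem_insert.1 hy with rfl | hy
  · exact hx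
  · exact htF y hy

theorem fitMod_inf (n : ℕ) : ∀ N E : LieIdeal ℤ g, N ≤ E → S.Def (ag N) → S.Def (ag E) →
    S.rk (ag E) - S.rk (ag N) ≤ n →
    S.Def (ag (fitMod N ⊓ E)) ∧ NilMod N (fitMod N ⊓ E) := by
  induction n using Nat.strong_induction_on with
  | _ n ih =>
  intro N E hNE hN hE hn
  set F := fitMod N ⊓ E
  have hNF : N ≤ F := le_inf (nilMod_of_le le_rfl).le_fitMod hNE
  have hFfit : F ≤ fitMod N := inf_le_left
  by_cases hZ : (ag N).relIndex (ag (almostCenter N E)) = 0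
  · obtain ⟨E₁, Z', hE₁, hZ', hNZ', hZE₁, hE₁E, hi, hZi, hc⟩ :=
      S.exists_central_section hNE hN hE hZ
    have h1 := S.rk_lt hN hZ' hNZ' hZi
    have h2 := S.rk_mono hZ' hE₁ hZE₁
    have h3 := S.rk_mono hE₁ hE hE₁E
    obtain ⟨hKd, k, hk⟩ := ih (S.rk (ag E₁) - S.rk (ag Z')) (by omega) Z' E₁ hZE₁ hZ' hE₁ le_rfl
    set K := fitMod Z' ⊓ E₁
    have hKN : NilMod N K := by
      -- Two more brackets with `K ≤ E₁` carry `Z'` into `N`.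
      refine ⟨k + 2, ?_⟩
      rw [LieIdeal.lcs_succ, LieIdeal.lcs_succ]
      refine le_trans ?_ hc
      exact LieSubmodule.mono_lie inf_le_right (LieSubmodule.mono_lie inf_le_right hk)
    have hKF : K ≤ F := le_inf hKN.le_fitMod (inf_le_right.trans hE₁E)
    have hFK : F ⊓ E₁ ≤ K := inf_le_inf_right _ (inf_le_left.trans (fitMod_mono hNZ'))
    have hKi : (ag K).relIndex (ag F) ≠ 0 := by
      refine relIndex_ne_zero_of_le_left (H := ag F ⊓ ag E₁) hFK ?_
      rw [AddSubgroup.inf_relIndex_left]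
      exact relIndex_ne_zero_of_le_right (inf_le_right : F ≤ E) hi
    exact ⟨S.of_relIndex_ne_zero hKd hKF hKi, hKN.of_relIndex_ne_zero hFfit hKi⟩
  · obtain ⟨t, htF, ht⟩ := S.exists_minimal_centralizer hN hE F
    set D := ag E ⊓ t.inf fun x => Interp.ctr (ag N) x
    have hD : S.Def D := S.inf hE (S.finset_inf _ _ fun x _ => S.ctr x hN)
    -- By Jacobi, `⁅z, d⁆` centralizes `x` if `d` centralizes `x` and `⁅x, z⁆`; the latter lies in
    -- `F`, so almost all of `D` centralizes it.
    have hinv : ∀ z : g, (D.comap (adHom z)).relIndex D ≠ 0 := by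
      intro z
      have h1 : (t.inf fun x => Interp.ctr (ag N) ⁅x, z⁆).relIndex D ≠ 0 :=
        relIndex_finset_inf_ne_zero _ _ fun x hx => ht _ (by
          rw [← lie_skew]
          exact neg_mem (F.lie_mem (htF x hx)))
      rw [← AddSubgroup.inf_relIndex_right] at h1
      refine relIndex_ne_zero_of_le_left ?_ h1
      rintro d ⟨hd1, hdE, hd2⟩
      refine ⟨E.lie_mem hdE, ?_⟩
      -- Passing to the generated subgroup lets `Finset.le_inf` prove membership in the infimum.
      have : ∀ x ∈ t, AddSubgroup.zmultiples ⁅z, d⁆ ≤ Interp.ctr (ag N) x := by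
        intro x hx
        rw [AddSubgroup.zmultiples_le, mem_ctr, leibniz_lie]
        refine AddSubgroup.add_mem _ ?_ (N.lie_mem ?_)
        · exact (Finset.inf_le (f := fun x => Interp.ctr (ag N) ⁅x, z⁆) hx) hd1
        · exact (Finset.inf_le (f := fun x => Interp.ctr (ag N) x) hx) hd2
      exact (Finset.le_inf this) (AddSubgroup.mem_zmultiples _)
    let E' : LieIdeal ℤ g := idealOf (Interp.act (ag N) D)
      (fun z x hx => lie_mem_act (fun z x hx => N.lie_mem hx) (hinv z) hx) ⊓ E
    have hE'E : E' ≤ E := inf_le_right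
    have hE' : S.Def (ag E') := S.inf (S.act hN hD) hE
    have hFE' : F ≤ E' := le_inf (fun x hx => ht x hx) inf_le_right
    have hNE' : N ≤ E' := hNF.trans hFE'
    by_cases hi : (ag E').relIndex (ag E) = 0
    · have h1 := S.rk_lt hE' hE hE'E hi
      have h2 := S.rk_mono hN hE' hNE'
      obtain h3 := ih (S.rk (ag E') - S.rk (ag N)) (by omega) N E' hNE' hN hE' le_rfl
      have : fitMod N ⊓ E' = F :=
        le_antisymm (inf_le_inf_left _ hE'E) (le_inf hFfit hFE')
      rwa [this] at h3
    · obtain ⟨k, hk⟩ := S.bounded hN hD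
      have h1 : (Interp.act (ag N) (ag E')).relIndex D ≠ 0 :=
        act_relIndex_ne_zero k fun x hx => ⟨hx.1, hk x hx.1⟩
      -- Elements of `D` that almost centralize `E'` almost centralize `E`, as `E'` has finite index
      -- there; so they lie in the almost centre, which is finite modulo `N`.
      have h2 : (ag N).relIndex D ≠ 0 := by
        have h3 : Interp.act (ag N) (ag E') ⊓ D ≤ ag (almostCenter N E) := by
          rintro y ⟨hy, hyD⟩
          refine ⟨?_, hyD.1⟩
          change (Interp.ctr (ag N) y).relIndex (ag E) ≠ 0
          have h4 : (Interp.ctr (ag N) y ⊓ ag E').relIndex (ag E') ≠ 0 := by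
            rw [AddSubgroup.inf_relIndex_right]
            exact hy
          exact relIndex_ne_zero_of_le_left inf_le_left (AddSubgroup.relIndex_ne_zero_trans h4 hi)
        rw [← AddSubgroup.inf_relIndex_right] at h1
        exact AddSubgroup.relIndex_ne_zero_trans (relIndex_ne_zero_of_le_right h3 hZ) h1
      have hFZ : F ≤ almostCenter N E := by
        classical
        intro x hx
        obtain ⟨I, hI, htI⟩ := exists_nilMod_of_finset (N := N) (insert x t) (fun y hy => by
          rcases Finset.mem_insert.1 hy with rfl | hy
          · exact hFfit hx
          · exact hFfit (htF y hy))
        have hIE : NilMod N (I ⊓ E) := hI.mono le_rfl inf_le_left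
        have h5 := relIndex_ne_zero_of_nilMod (t := t)
          (I := I ⊓ E) (fun y hy => ⟨htI y (by simp [hy]), (htF y hy).2⟩) inf_le_right hIE h2
        refine ⟨?_, hx.2⟩
        change (Interp.ctr (ag N) x).relIndex (ag E) ≠ 0
        -- The map `adHom x` sends `E` into `I ⊓ E`, finite modulo `N`, so the centralizer of `x`
        -- has finite index in `E`.
        rw [Interp.ctr, AddSubgroup.relIndex_comap]
        refine relIndex_ne_zero_of_le_right ?_ h5
        rintro _ ⟨y, hy, rfl⟩
        have hxI : x ∈ I ⊓ E := ⟨htI x (by simp), hx.2⟩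
        rw [adHom_apply, ← lie_skew]
        exact neg_mem ((I ⊓ E).lie_mem hxI)
      have hFi : (ag N).relIndex (ag F) ≠ 0 := relIndex_ne_zero_of_le_right hFZ hZ
      exact ⟨S.of_relIndex_ne_zero hN hNF hFi,
        (nilMod_of_le le_rfl).of_relIndex_ne_zero hFfit hFi⟩

theorem fittingIdeal_def_and_isNilpotent :
    S.Def (ag (fittingIdeal g)) ∧ LieRing.IsNilpotent (fittingIdeal g) := by
  have h := S.fitMod_inf _ ⊥ ⊤ bot_le S.bot S.top le_rfl
  rw [inf_top_eq, ← fittingIdeal_eq_fitMod_bot] at h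
  exact ⟨h.1, isNilpotent_iff_nilMod_bot.2 h.2⟩

end DefSystem

end Interp

namespace Interp

/-! ### Definable relations on an interpretable group -/

section Definability

variable {L : FirstOrder.Language.{u, v}} {M : Type w} [L.Structure M]

theorem definable_subst {α β : Type*} {S : Set (α ⊕ β → M)}
    (hS : (Set.univ : Set M).Definable L S) (b : β → M) :
    (Set.univ : Set M).Definable L {p : α → M | Sum.elim p b ∈ S} := by
  rw [Set.definable_iff_exists_formula_sum] at hS ⊢
  obtain ⟨φ, rfl⟩ := hS
  refine ⟨φ.relabel (Sum.elim Sum.inl (Sum.elim Sum.inr fun j => Sum.inl ⟨b j, trivial⟩)), ?_⟩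
  ext p
  simp only [Set.mem_ofPred_eq, Formula.realize_relabel]
  refine iff_of_eq (congrArg _ (funext fun i => ?_))
  rcases i with i | i | i <;> rfl

theorem definable_coord_eq {α : Type*} (i j : α) :
    (Set.univ : Set M).Definable L {p : α → M | p i = p j} :=
  ⟨(Term.var i).equal (Term.var j), by ext; simp⟩

variable {G : Type*}

/-- The set of tuples of representatives of the elements of `S`. -/
def pull {n : ℕ} (Rep : G → (Fin n → M) → Prop) {α : Type*} (S : Set (α → G)) :
    Set (α × Fin n → M) :=
  {p | ∃ x ∈ S, ∀ i, Rep (x i) fun j => p (i, j)}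

variable (L M G) in
/-- A presentation of the abelian group `G` as a group interpretable in `M`. -/
structure Coords [AddCommGroup G] where
  /-- The arity. -/
  n : ℕ
  /-- The tuple represents the element. -/
  Rep : G → (Fin n → M) → Prop
  exists_rep : ∀ x, ∃ p, Rep x p
  unique : ∀ {x y p}, Rep x p → Rep y p → x = y
  definable_add : (Set.univ : Set M).Definable L (pull Rep {x : Fin 3 → G | x 0 + x 1 = x 2})

namespace Coords

variable [AddCommGroup G] (C : Coords L M G)

/-- The set `S` of tuples of elements of `G` is definable, with parameters. -/
def DefS {α : Type*} (S : Set (α → G)) : Prop := (Set.univ : Set M).Definable L (pull C.Rep S)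

variable {α β : Type*} {C}

theorem DefS.congr {S T : Set (α → G)} (hS : C.DefS S) (h : ∀ x, x ∈ T ↔ x ∈ S) : C.DefS T := by
  rwa [Set.ext h]

variable (C) in
theorem mem_pull_iff {S : Set (α → G)} {x : α → G} {p : α × Fin C.n → M}
    (h : ∀ i, C.Rep (x i) fun j => p (i, j)) : p ∈ pull C.Rep S ↔ x ∈ S := by
  constructor
  · rintro ⟨y, hy, hyp⟩
    have : x = y := funext fun i => C.unique (h i) (hyp i)
    rwa [this]
  · exact fun hx => ⟨x, hx, h⟩

theorem DefS.inter {S T : Set (α → G)} (hS : C.DefS S) (hT : C.DefS T) : C.DefS (S ∩ T) := by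
  have : pull C.Rep (S ∩ T) = pull C.Rep S ∩ pull C.Rep T := by
    ext p
    constructor
    · rintro ⟨x, ⟨h1, h2⟩, hp⟩
      exact ⟨⟨x, h1, hp⟩, ⟨x, h2, hp⟩⟩
    · rintro ⟨⟨x, h1, hp⟩, h2⟩
      exact ⟨x, ⟨h1, (C.mem_pull_iff hp).1 h2⟩, hp⟩
  rw [DefS, this]
  exact Set.Definable.inter hS hT

theorem DefS.union {S T : Set (α → G)} (hS : C.DefS S) (hT : C.DefS T) : C.DefS (S ∪ T) := by
  have : pull C.Rep (S ∪ T) = pull C.Rep S ∪ pull C.Rep T := by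
    ext p
    constructor
    · rintro ⟨x, h1 | h2, hp⟩
      · exact Or.inl ⟨x, h1, hp⟩
      · exact Or.inr ⟨x, h2, hp⟩
    · rintro (⟨x, h1, hp⟩ | ⟨x, h1, hp⟩)
      · exact ⟨x, Or.inl h1, hp⟩
      · exact ⟨x, Or.inr h1, hp⟩
  rw [DefS, this]
  exact Set.Definable.union hS hT

variable (C) in
-- Since `x + 0 = x`, the domain is a projection of the graph of addition.
theorem definable_domain : (Set.univ : Set M).Definable L {p : Fin C.n → M | ∃ x, C.Rep x p} := by
  have h := C.definable_add.image_comp (fun j : Fin C.n => ((0 : Fin 3), j))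
  convert h using 1
  ext p
  constructor
  · rintro ⟨x, hx⟩
    obtain ⟨q, hq⟩ := C.exists_rep 0
    refine ⟨fun i => ![p, q, p] i.1 i.2, ⟨![x, 0, x], by simp, fun i => ?_⟩, rfl⟩
    fin_cases i
    · exact hx
    · exact hq
    · exact hx
  · rintro ⟨p, ⟨x, -, hp⟩, rfl⟩
    exact ⟨x 0, hp 0⟩

variable (C) in
theorem defS_univ [Finite α] : C.DefS (Set.univ : Set (α → G)) := by
  have h := Set.definable_iInter_of_finite (fun i : α =>
    (definable_domain C).preimage_comp (fun j : Fin C.n => (i, j)))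
  unfold DefS
  convert h using 1
  ext p
  simp only [Set.mem_iInter, Set.mem_preimage, Set.mem_ofPred_eq]
  constructor
  · rintro ⟨x, -, hp⟩ i
    exact ⟨x i, hp i⟩
  · intro h
    choose x hx using h
    exact ⟨x, trivial, hx⟩

theorem DefS.compl [Finite α] {S : Set (α → G)} (hS : C.DefS S) : C.DefS Sᶜ := by
  have : pull C.Rep Sᶜ = pull C.Rep (Set.univ : Set (α → G)) \ pull C.Rep S := by
    ext p
    constructor
    · rintro ⟨x, h1, hp⟩
      exact ⟨⟨x, trivial, hp⟩, fun h => h1 ((C.mem_pull_iff hp).1 h)⟩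
    · rintro ⟨⟨x, -, hp⟩, h2⟩
      exact ⟨x, fun h => h2 ((C.mem_pull_iff hp).2 h), hp⟩
  rw [DefS, this]
  exact Set.Definable.sdiff (C.defS_univ) hS

theorem DefS.reindex [Finite β] {S : Set (α → G)} (hS : C.DefS S) (f : α → β) :
    C.DefS {x : β → G | (fun i => x (f i)) ∈ S} := by
  have : pull C.Rep {x : β → G | (fun i => x (f i)) ∈ S} = pull C.Rep (Set.univ : Set (β → G)) ∩
      (fun p : β × Fin C.n → M => p ∘ Prod.map f id) ⁻¹' pull C.Rep S := by
    ext p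
    constructor
    · rintro ⟨x, h1, hp⟩
      exact ⟨⟨x, trivial, hp⟩, ⟨_, h1, fun i => hp (f i)⟩⟩
    · rintro ⟨⟨x, -, hp⟩, h2⟩
      exact ⟨x, (C.mem_pull_iff (p := p ∘ Prod.map f id) (fun i => hp (f i))).1 h2, hp⟩
  rw [DefS, this]
  exact Set.Definable.inter C.defS_univ (Set.Definable.preimage_comp _ hS)

theorem DefS.exists [Finite α] [Finite β] {S : Set (α ⊕ β → G)} (hS : C.DefS S) :
    C.DefS {x : α → G | ∃ y : β → G, Sum.elim x y ∈ S} := by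
  have h := Set.Definable.image_comp hS (Prod.map (Sum.inl : α → α ⊕ β) (id : Fin C.n → Fin C.n))
  unfold DefS
  convert h using 1
  ext p
  constructor
  · rintro ⟨x, ⟨y, hy⟩, hp⟩
    choose q hq using fun i => C.exists_rep (y i)
    refine ⟨fun i => Sum.elim (fun a j => p (a, j)) q i.1 i.2, ⟨_, hy, fun i => ?_⟩, rfl⟩
    rcases i with i | i
    · exact hp i
    · exact hq i
  · rintro ⟨p, ⟨x, hx, hp⟩, rfl⟩
    refine ⟨fun i => x (Sum.inl i), ⟨fun i => x (Sum.inr i), ?_⟩, fun i => hp (Sum.inl i)⟩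
    convert hx
    ext i
    rcases i with i | i <;> rfl

theorem DefS.subst {S : Set (α ⊕ β → G)} (hS : C.DefS S) (y : β → G) :
    C.DefS {x : α → G | Sum.elim x y ∈ S} := by
  choose q hq using fun i => C.exists_rep (y i)
  have h := definable_subst (Set.Definable.preimage_comp (A := Set.univ) (L := L)
    (fun i : (α ⊕ β) × Fin C.n => (Sum.elim (fun a => Sum.inl (a, i.2)) (fun b => Sum.inr (b, i.2))
      i.1 : (α × Fin C.n) ⊕ (β × Fin C.n))) hS) (fun i => q i.1 i.2)
  unfold DefS
  convert h using 1
  ext p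
  simp only [Set.mem_ofPred_eq, Set.mem_preimage]
  constructor
  · rintro ⟨x, hx, hp⟩
    refine ⟨_, hx, fun i => ?_⟩
    rcases i with i | i
    · exact hp i
    · exact hq i
  · rintro ⟨x, hx, hp⟩
    refine ⟨fun i => x (Sum.inl i), ?_, fun i => hp (Sum.inl i)⟩
    have : x = Sum.elim (fun i => x (Sum.inl i)) y := by
      ext i
      rcases i with i | i
      · rfl
      · exact C.unique (hp (Sum.inr i)) (hq i)
    rw [Set.mem_ofPred_eq, ← this]
    exact hx

theorem defS_iInter {ι : Type*} [Finite ι] [Finite α] {S : ι → Set (α → G)}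
    (hS : ∀ i, C.DefS (S i)) : C.DefS (⋂ i, S i) := by
  classical
  cases nonempty_fintype ι
  have key : ∀ t : Finset ι, C.DefS (⋂ i ∈ t, S i) := by
    intro t
    induction t using Finset.induction_on with
    | empty => simpa using C.defS_univ
    | insert a t _ ih =>
      rw [Finset.set_biInter_insert]
      exact (hS a).inter ih
  simpa using key Finset.univ

theorem defS_biUnion {ι : Type*} [Finite α] (t : Finset ι) {S : ι → Set (α → G)}
    (hS : ∀ i ∈ t, C.DefS (S i)) : C.DefS (⋃ i ∈ t, S i) := by
  classical
  induction t using Finset.induction_on with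
  | empty =>
    refine (C.defS_univ (α := α)).compl.congr ?_
    simp
  | insert a t _ ih =>
    rw [Finset.set_biUnion_insert]
    exact (hS a (by simp)).union (ih fun i hi => hS i (by simp [hi]))

variable (C) in
theorem defS_add [Finite α] (i j k : α) : C.DefS {x : α → G | x i + x j = x k} :=
  (DefS.reindex (C := C) C.definable_add ![i, j, k]).congr fun _ => Iff.rfl

/-- Substituting a difference for a variable. -/
theorem DefS.sub_mem [Finite α] {S : Set (α ⊕ Unit → G)} (hS : C.DefS S) (i j : α) :
    C.DefS {x : α → G | Sum.elim x (fun _ => x i - x j) ∈ S} := by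
  refine (hS.inter (C.defS_add (Sum.inr ()) (Sum.inl j) (Sum.inl i))).exists.congr fun x => ?_
  constructor
  · intro h
    exact ⟨_, h, by simp⟩
  · rintro ⟨y, hy, h⟩
    have : y = fun _ => x i - x j := funext fun u => by
      cases u
      rw [eq_sub_iff_add_eq]
      exact h
    rw [Set.mem_ofPred_eq, ← this]
    exact hy

variable (C)

/-- The subset `A` of `G` is definable. -/
def DefSet (A : Set G) : Prop := C.DefS {x : Unit → G | x () ∈ A}

/-- The family `A` of subsets of `G` is definable. -/
def DefFam (A : G → Set G) : Prop := C.DefS {x : Bool → G | x true ∈ A (x false)}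

variable {C}

theorem DefSet.mem [Finite α] {A : Set G} (hA : C.DefSet A) (i : α) :
    C.DefS {x : α → G | x i ∈ A} := DefS.reindex hA (fun _ => i)

theorem DefFam.mem [Finite α] {A : G → Set G} (hA : C.DefFam A) (i j : α) :
    C.DefS {x : α → G | x j ∈ A (x i)} :=
  (DefS.reindex hA (fun b => if b = true then j else i)).congr fun x => by simp

theorem DefFam.apply {A : G → Set G} (hA : C.DefFam A) (x : G) : C.DefSet (A x) :=
  ((hA.mem (Sum.inr () : Unit ⊕ Unit) (Sum.inl ())).subst fun _ => x).congr fun _ => Iff.rfl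

theorem DefSet.sub_mem [Finite α] {A : Set G} (hA : C.DefSet A) (i j : α) :
    C.DefS {x : α → G | x i - x j ∈ A} :=
  ((hA.mem (Sum.inr () : α ⊕ Unit)).sub_mem i j).congr fun _ => Iff.rfl

theorem DefFam.sub_mem [Finite α] {A : G → Set G} (hA : C.DefFam A) (i j k : α) :
    C.DefS {x : α → G | x i - x j ∈ A (x k)} :=
  ((hA.mem (Sum.inl k : α ⊕ Unit) (Sum.inr ())).sub_mem i j).congr fun _ => Iff.rfl

theorem DefSet.translate {A : Set G} (hA : C.DefSet A) (c : G) : C.DefSet {x | x - c ∈ A} :=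
  ((hA.sub_mem (Sum.inl () : Unit ⊕ Unit) (Sum.inr ())).subst fun _ => c).congr fun _ => Iff.rfl

variable (C) in
theorem defSet_zero : C.DefSet {0} :=
  (C.defS_add () () ()).congr fun x => by simp

theorem DefSet.of_relIndex_ne_zero {H K : AddSubgroup G} (hH : C.DefSet (H : Set G)) (hHK : H ≤ K)
    (h : H.relIndex K ≠ 0) : C.DefSet (K : Set G) := by
  obtain ⟨t, htK, ht⟩ := exists_finset_of_relIndex_ne_zero h
  refine (defS_biUnion t (fun z _ => hH.translate z)).congr fun x => ?_
  simp only [Set.mem_iUnion, Set.mem_ofPred_eq, SetLike.mem_coe]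
  constructor
  · intro hx
    obtain ⟨z, hz, hxz⟩ := ht _ hx
    exact ⟨z, hz, hxz⟩
  · rintro ⟨z, hz, hxz⟩
    simpa using K.add_mem (hHK hxz) (htK z hz)

theorem defSet_hasSeparated {H : G → AddSubgroup G} (hH : C.DefFam fun x => (H x : Set G))
    {D : AddSubgroup G} (hD : C.DefSet (D : Set G)) (m : ℕ) :
    C.DefSet {x | HasSeparated m (H x) D} := by
  have h1 : C.DefS (⋂ i : Fin m, {x : Unit ⊕ Fin m → G | x (Sum.inr i) ∈ (D : Set G)}) :=
    defS_iInter fun i => hD.mem _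
  have h2 : C.DefS (⋂ p : {p : Fin m × Fin m // p.1 ≠ p.2}, {x : Unit ⊕ Fin m → G |
      x (Sum.inr p.1.1) - x (Sum.inr p.1.2) ∈ (H (x (Sum.inl ())) : Set G)}ᶜ) :=
    defS_iInter fun p => (hH.sub_mem _ _ _).compl
  refine (h1.inter h2).exists.congr fun x => ?_
  simp only [Set.mem_ofPred_eq, HasSeparated, Set.mem_inter_iff, Set.mem_iInter, Sum.elim_inr,
    Sum.elim_inl, Set.mem_compl_iff, SetLike.mem_coe, Subtype.forall, Prod.forall]
  rfl

end Coords

end Definability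

end Interp

namespace Interp

namespace Coords

/-! ### Quotients by definable subgroups as interpretable sets -/

section Quotients

variable {L : FirstOrder.Language.{u, v}} {M : Type w} [L.Structure M]
variable {G : Type*} [AddCommGroup G] (C : Coords L M G)

/-- Congruence of representatives modulo the subgroup `H`. -/
def cosetSetoid (H : AddSubgroup G) : Setoid (Fin C.n → M) where
  -- The disjunct `p = q` gives reflexivity at tuples that represent no element.
  r p q := p = q ∨ ∃ x y, C.Rep x p ∧ C.Rep y q ∧ x - y ∈ H
  iseqv :=
    { refl := fun _ => Or.inl rfl
      symm := by
        rintro p q (rfl | ⟨x, y, hx, hy, h⟩)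
        · exact Or.inl rfl
        · exact Or.inr ⟨y, x, hy, hx, by simpa using H.neg_mem h⟩
      trans := by
        rintro p q r (rfl | ⟨x, y, hx, hy, h⟩) (rfl | ⟨y', z, hy', hz, h'⟩)
        · exact Or.inl rfl
        · exact Or.inr ⟨y', z, hy', hz, h'⟩
        · exact Or.inr ⟨x, y, hx, hy, h⟩
        · obtain rfl := C.unique hy hy'
          exact Or.inr ⟨x, z, hx, hz, by simpa using H.add_mem h h'⟩ }

theorem cosetSetoid_apply {H : AddSubgroup G} {p q : Fin C.n → M} :
    C.cosetSetoid H p q ↔ p = q ∨ ∃ x y, C.Rep x p ∧ C.Rep y q ∧ x - y ∈ H := Iff.rfl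

theorem definableRel_cosetSetoid {H : AddSubgroup G} (hH : C.DefSet (H : Set G)) :
    DefinableRel L (C.cosetSetoid H) := by
  have h1 : (Set.univ : Set M).Definable L
      {p : Fin C.n ⊕ Fin C.n → M | ∀ i, p (Sum.inl i) = p (Sum.inr i)} := by
    convert Set.definable_iInter_of_finite (fun i : Fin C.n =>
      definable_coord_eq (L := L) (M := M) (Sum.inl i : Fin C.n ⊕ Fin C.n) (Sum.inr i)) using 1
    ext p
    simp
  have h2 := Set.Definable.preimage_comp (A := (Set.univ : Set M)) (L := L)
    (fun i : Bool × Fin C.n => (if i.1 = true then Sum.inl i.2 else Sum.inr i.2 :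
      Fin C.n ⊕ Fin C.n)) (hH.sub_mem true false)
  unfold DefinableRel
  convert h1.union h2 using 1
  ext p
  simp only [Set.mem_ofPred_eq, Set.mem_union, Set.mem_preimage, cosetSetoid_apply]
  refine or_congr ⟨fun h i => congrFun h i, fun h => funext h⟩ ⟨?_, ?_⟩
  · rintro ⟨x, y, hx, hy, h⟩
    refine ⟨fun b => if b = true then x else y, by simpa using h, fun i => ?_⟩
    cases i
    · simpa using hy
    · simpa using hx
  · rintro ⟨x, h, hx⟩
    exact ⟨_, _, hx true, hx false, h⟩

/-- The class of an element modulo `H`. -/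
noncomputable def cls (H : AddSubgroup G) (x : G) : Quotient (C.cosetSetoid H) :=
  Quotient.mk _ (C.exists_rep x).choose

theorem mk_eq_cls {H : AddSubgroup G} {x : G} {p : Fin C.n → M} (h : C.Rep x p) :
    Quotient.mk (C.cosetSetoid H) p = C.cls H x :=
  Quotient.sound (Or.inr ⟨x, x, h, (C.exists_rep x).choose_spec, by simp⟩)

theorem cls_eq_cls {H : AddSubgroup G} {x y : G} : C.cls H x = C.cls H y ↔ x - y ∈ H := by
  have hx := (C.exists_rep x).choose_spec
  have hy := (C.exists_rep y).choose_spec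
  rw [cls, cls, Quotient.eq]
  constructor
  · rintro (h | ⟨x', y', hx', hy', h⟩)
    · rw [h] at hx
      rw [C.unique hx hy]
      simp
    · rwa [C.unique hx hx', C.unique hy hy']
  · exact fun h => Or.inr ⟨x, y, hx, hy, h⟩

theorem mk_eq_cls_iff {H : AddSubgroup G} {x : G} {p : Fin C.n → M} :
    Quotient.mk (C.cosetSetoid H) p = C.cls H x ↔ ∃ y, C.Rep y p ∧ y - x ∈ H := by
  constructor
  · intro h
    have hx := (C.exists_rep x).choose_spec
    rcases Quotient.exact h with h' | ⟨y, x', hy, hx', h'⟩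
    · exact ⟨x, h' ▸ hx, by simp⟩
    · exact ⟨y, hy, by rwa [C.unique hx hx']⟩
  · rintro ⟨y, hy, h⟩
    rw [C.mk_eq_cls hy, cls_eq_cls]
    exact h

/-- `A` is a union of cosets of `H`. -/
def Saturated (H : AddSubgroup G) (A : Set G) : Prop := ∀ x ∈ A, ∀ y, y - x ∈ H → y ∈ A

theorem saturated_bot (A : Set G) : Saturated ⊥ A := fun x hx y h => by
  rw [AddSubgroup.mem_bot, sub_eq_zero] at h
  rwa [h]

theorem saturated_of_le {H K : AddSubgroup G} (h : H ≤ K) : Saturated H (K : Set G) :=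
  fun x hx y hy => by simpa using K.add_mem (h hy) hx

theorem mk_mem_image_cls {H : AddSubgroup G} {A : Set G} (hA : Saturated H A) {p : Fin C.n → M} :
    Quotient.mk (C.cosetSetoid H) p ∈ C.cls H '' A ↔ ∃ x ∈ A, C.Rep x p := by
  constructor
  · rintro ⟨x, hx, h⟩
    obtain ⟨y, hy, hyx⟩ := C.mk_eq_cls_iff.1 h.symm
    exact ⟨y, hA x hx y hyx, hy⟩
  · rintro ⟨x, hx, h⟩
    exact ⟨x, hx, (C.mk_eq_cls h).symm⟩

theorem interpretableSet_image_cls {H : AddSubgroup G} {A : Set G} (hA : Saturated H A)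
    (hAd : C.DefSet A) : InterpretableSet L (C.cosetSetoid H) (C.cls H '' A) := by
  have h := Set.Definable.preimage_comp (A := (Set.univ : Set M)) (L := L)
    (fun i : Unit × Fin C.n => i.2) hAd
  unfold InterpretableSet
  convert h using 1
  ext p
  simp only [Set.mem_ofPred_eq, Set.mem_preimage]
  rw [C.mk_mem_image_cls hA]
  constructor
  · rintro ⟨x, hx, hp⟩
    exact ⟨fun _ => x, hx, fun _ => hp⟩
  · rintro ⟨x, hx, hp⟩
    exact ⟨_, hx, hp ()⟩

end Quotients

/-! ### The rank coming from dimension -/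

section Rank

variable {L : FirstOrder.Language.{u, v}} {T : L.Theory}
variable {dim : ∀ (M : Theory.ModelType.{u, v, w} T) (n : ℕ) (E : Setoid (Fin n → M)),
  Set (Quotient E) → WithBot ℕ} (hdim : IsDimension T dim)
variable {M : Theory.ModelType.{u, v, w} T} {G : Type*} [AddCommGroup G] (C : Coords L M G)

theorem DefSet.coset {H : AddSubgroup G} {C : Coords L M G} (hH : C.DefSet (H : Set G)) (a : G) :
    C.DefSet {x | x - a ∈ H} := hH.translate a

include hdim

/-- The coset of `a` inside `A` is a single point modulo `H`, of dimension `0`, and adjoining it to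
`A` changes nothing. -/
theorem dim_nonneg {H : AddSubgroup G} {A : Set G} (hH : C.DefSet (H : Set G))
    (hA : Saturated H A) (hAd : C.DefSet A) {a : G} (ha : a ∈ A) :
    0 ≤ dim M C.n (C.cosetSetoid H) (C.cls H '' A) := by
  have hs : Saturated H {x | x - a ∈ H} := fun x hx y hy => by
    have := H.add_mem hy hx
    simpa using this
  have hi := C.interpretableSet_image_cls hs (hH.coset a)
  have h0 : dim M C.n (C.cosetSetoid H) (C.cls H '' {x | x - a ∈ H}) = 0 := by
    rw [hdim.eq_zero_iff _ _ _ _ (C.definableRel_cosetSetoid hH) hi]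
    refine ⟨⟨_, a, by simp, rfl⟩, (Set.finite_singleton (C.cls H a)).subset ?_⟩
    rintro _ ⟨x, hx, rfl⟩
    exact C.cls_eq_cls.2 hx
  have h1 := hdim.union _ _ _ _ _ (C.definableRel_cosetSetoid hH)
    (C.interpretableSet_image_cls hA hAd) hi
  have h2 : C.cls H '' A ∪ C.cls H '' {x | x - a ∈ H} = C.cls H '' A := by
    rw [← Set.image_union]
    congr 1
    exact Set.union_eq_left.2 fun x hx => hA a ha x hx
  rw [h2, h0] at h1
  rw [h1]
  exact le_max_right _ _

theorem dim_mono {A B : Set G} (hA : C.DefSet A) (hB : C.DefSet B) (h : A ⊆ B) :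
    dim M C.n (C.cosetSetoid ⊥) (C.cls ⊥ '' A) ≤ dim M C.n (C.cosetSetoid ⊥) (C.cls ⊥ '' B) := by
  have h1 := hdim.union _ _ _ _ _ (C.definableRel_cosetSetoid (H := ⊥) C.defSet_zero)
    (C.interpretableSet_image_cls (saturated_bot A) hA)
    (C.interpretableSet_image_cls (saturated_bot B) hB)
  rw [← Set.image_union, Set.union_eq_right.2 h] at h1
  rw [h1]
  exact le_max_left _ _

/-- The lower fibre inequality for the map from the points of `A` to the classes of `B` modulo `H`
induced by `φ`. -/
theorem dim_add_le {A B : Set G} {H : AddSubgroup G} (φ : G → G) (k : ℕ)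
    (hA : C.DefSet A) (hB : C.DefSet B) (hH : C.DefSet (H : Set G)) (hBs : Saturated H B)
    (hφ : C.DefS {x : Bool → G | φ (x false) - x true ∈ H}) (hAB : ∀ a ∈ A, φ a ∈ B)
    (hk : ∀ b ∈ B, (k : WithBot ℕ) ≤
      dim M C.n (C.cosetSetoid ⊥) (C.cls ⊥ '' {a ∈ A | φ a - b ∈ H})) :
    dim M C.n (C.cosetSetoid H) (C.cls H '' B) + k ≤
      dim M C.n (C.cosetSetoid ⊥) (C.cls ⊥ '' A) := by
  classical
  let f : (C.cls ⊥ '' A) → (C.cls H '' B) := fun q =>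
    ⟨C.cls H (φ q.2.choose), _, hAB _ q.2.choose_spec.1, rfl⟩
  have hf : ∀ a (ha : a ∈ A) (h : C.cls ⊥ a ∈ C.cls ⊥ '' A),
      (f ⟨C.cls ⊥ a, h⟩ : Quotient (C.cosetSetoid H)) = C.cls H (φ a) := by
    intro a ha h
    have h1 := h.choose_spec.2
    rw [cls_eq_cls, AddSubgroup.mem_bot, sub_eq_zero] at h1
    change C.cls H (φ h.choose) = _
    rw [h1]
  refine hdim.le_of_fibers M _ _ _ _ _ _ f k (C.definableRel_cosetSetoid (H := ⊥) C.defSet_zero)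
    (C.definableRel_cosetSetoid hH) (C.interpretableSet_image_cls (saturated_bot A) hA)
    (C.interpretableSet_image_cls hBs hB) ?_ ?_
  · have h := Set.Definable.preimage_comp (A := (Set.univ : Set M)) (L := L)
      (fun i : Bool × Fin C.n => (if i.1 = true then Sum.inr i.2 else Sum.inl i.2 :
        Fin C.n ⊕ Fin C.n)) ((hA.mem false).inter hφ)
    unfold InterpretableFun
    convert h using 1
    ext p
    simp only [Set.mem_ofPred_eq, Set.mem_preimage]
    constructor
    · rintro ⟨hm, he⟩
      obtain ⟨x, hx, hxp⟩ := (C.mk_mem_image_cls (saturated_bot A)).1 hm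
      have hmk := C.mk_eq_cls (H := ⊥) hxp
      have he' : C.cls H (φ x) = Quotient.mk _ fun i => p (Sum.inr i) := by
        rw [← he, ← hf x hx (hmk ▸ hm)]
        congr 2
        exact Subtype.ext hmk.symm
      obtain ⟨y, hy, hyx⟩ := C.mk_eq_cls_iff.1 he'.symm
      refine ⟨fun b => if b = true then y else x, ⟨by simpa using hx, ?_⟩, fun i => ?_⟩
      · have := H.neg_mem hyx
        simpa using this
      · cases i
        · simpa using hxp
        · simpa using hy
    · rintro ⟨x, ⟨hx, hφx⟩, hp⟩
      have h1 : C.Rep (x false) fun i => p (Sum.inl i) := hp false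
      have h2 : C.Rep (x true) fun i => p (Sum.inr i) := hp true
      have hmk := C.mk_eq_cls (H := ⊥) h1
      have hm : Quotient.mk (C.cosetSetoid ⊥) (fun i => p (Sum.inl i)) ∈ C.cls ⊥ '' A :=
        (C.mk_mem_image_cls (saturated_bot A)).2 ⟨_, hx, h1⟩
      refine ⟨hm, ?_⟩
      rw [C.mk_eq_cls h2, ← C.cls_eq_cls.2 hφx, ← hf _ hx (hmk ▸ hm)]
      congr 2
      exact Subtype.ext hmk
  · rintro ⟨_, b, hb, rfl⟩
    have : Subtype.val '' (f ⁻¹' {⟨C.cls H b, b, hb, rfl⟩}) =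
        C.cls ⊥ '' {a ∈ A | φ a - b ∈ H} := by
      ext q
      constructor
      · rintro ⟨⟨_, a, ha, rfl⟩, hq, rfl⟩
        have := congrArg Subtype.val (Set.mem_singleton_iff.1 hq)
        rw [hf a ha ⟨a, ha, rfl⟩] at this
        exact ⟨a, ⟨ha, C.cls_eq_cls.1 this⟩, rfl⟩
      · rintro ⟨a, ⟨ha, hab⟩, rfl⟩
        refine ⟨⟨_, a, ha, rfl⟩, ?_, rfl⟩
        rw [Set.mem_preimage, Set.mem_singleton_iff, Subtype.ext_iff, hf a ha ⟨a, ha, rfl⟩]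
        exact C.cls_eq_cls.2 hab
    rw [this]
    exact hk b hb

/-- Translation by `-b` maps the coset onto `H` with non-empty fibres; this is the fibre inequality
with `k = 0`. -/
theorem dim_le_dim_coset {H : AddSubgroup G} (hH : C.DefSet (H : Set G)) (b : G) :
    dim M C.n (C.cosetSetoid ⊥) (C.cls ⊥ '' (H : Set G)) ≤
      dim M C.n (C.cosetSetoid ⊥) (C.cls ⊥ '' {x | x - b ∈ H}) := by
  have hA := hH.coset b
  have hφ : C.DefS {x : Bool → G | x false - b - x true ∈ (⊥ : AddSubgroup G)} := by
    refine ((C.defS_add (Sum.inl true : Bool ⊕ Unit) (Sum.inr ()) (Sum.inl false)).subst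
      fun _ => b).congr fun x => ?_
    simp only [Set.mem_ofPred_eq, AddSubgroup.mem_bot, Sum.elim_inl, Sum.elim_inr]
    constructor
    · intro h
      rw [← sub_eq_zero, ← neg_eq_zero, ← h]
      abel
    · intro h
      rw [← h]
      abel
  have := C.dim_add_le hdim (fun x => x - b) 0 hA hH (H := ⊥) C.defSet_zero (saturated_bot _) hφ
    (fun a ha => ha) (fun c hc => by
      refine C.dim_nonneg hdim (H := ⊥) C.defSet_zero (saturated_bot _) ?_ (a := c + b) ?_
      · refine (hA.inter (C.defSet_zero.translate (c + b))).congr fun x => ?_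
        simp [sub_sub, add_comm]
      · simpa using hc)
  simpa using this

theorem one_le_dim {H K : AddSubgroup G} (hH : C.DefSet (H : Set G)) (hK : C.DefSet (K : Set G))
    (hHK : H ≤ K) (h : H.relIndex K = 0) :
    1 ≤ dim M C.n (C.cosetSetoid H) (C.cls H '' (K : Set G)) := by
  have h0 := C.dim_nonneg hdim hH (saturated_of_le hHK) hK K.zero_mem
  have h1 : dim M C.n (C.cosetSetoid H) (C.cls H '' (K : Set G)) ≠ 0 := by
    rw [Ne, hdim.eq_zero_iff _ _ _ _ (C.definableRel_cosetSetoid hH)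
      (C.interpretableSet_image_cls (saturated_of_le hHK) hK)]
    rintro ⟨-, hfin⟩
    have := hfin.to_subtype
    obtain ⟨y, hy, hs⟩ := relIndex_eq_zero_iff.1 h
      (Nat.card (C.cls H '' (K : Set G)) + 1)
    have hinj : Function.Injective
        (fun i => (⟨C.cls H (y i), y i, hy i, rfl⟩ : C.cls H '' (K : Set G))) := by
      intro i j hij
      by_contra hne
      exact hs hne (C.cls_eq_cls.1 (congrArg Subtype.val hij))
    have := Nat.card_le_card_of_injective _ hinj
    rw [Nat.card_fin] at this
    exact absurd this (Nat.not_succ_le_self _)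
  generalize dim M C.n (C.cosetSetoid H) (C.cls H '' (K : Set G)) = d at *
  induction d with
  | bot => simp at h0
  | coe d =>
    have : d ≠ 0 := fun h => h1 (by rw [h]; rfl)
    exact WithBot.coe_le_coe.2 (Nat.one_le_iff_ne_zero.2 this)

/-- The fibres of `K → K/H` are cosets of `H`, of dimension at least `rk H`, and an infinite base
has dimension at least `1`. -/
theorem exists_rank : ∃ rk : AddSubgroup G → ℕ,
    (∀ H K : AddSubgroup G, C.DefSet (H : Set G) → C.DefSet (K : Set G) → H ≤ K → rk H ≤ rk K) ∧
    (∀ H K : AddSubgroup G, C.DefSet (H : Set G) → C.DefSet (K : Set G) → H ≤ K →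
      H.relIndex K = 0 → rk H < rk K) := by
  have key : ∀ H : AddSubgroup G, ∃ r : ℕ, C.DefSet (H : Set G) →
      dim M C.n (C.cosetSetoid ⊥) (C.cls ⊥ '' (H : Set G)) = r := by
    intro H
    by_cases hH : C.DefSet (H : Set G)
    · have h0 := C.dim_nonneg hdim (H := ⊥) C.defSet_zero (saturated_bot _) hH H.zero_mem
      generalize dim M C.n (C.cosetSetoid ⊥) (C.cls ⊥ '' (H : Set G)) = d at *
      induction d with
      | bot => simp at h0
      | coe d => exact ⟨d, fun _ => rfl⟩
    · exact ⟨0, fun h => (hH h).elim⟩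
  choose rk hrk using key
  refine ⟨rk, fun H K hH hK hHK => ?_, fun H K hH hK hHK h => ?_⟩
  · have := C.dim_mono hdim hH hK hHK
    rw [hrk H hH, hrk K hK] at this
    exact_mod_cast this
  · have h1 := C.one_le_dim hdim hH hK hHK h
    have h2 := C.dim_add_le hdim id (rk H) hK hK hH (saturated_of_le hHK)
      (hH.sub_mem false true) (fun a ha => ha) (fun b hb => by
        have h3 := C.dim_le_dim_coset hdim hH b
        rw [hrk H hH] at h3
        refine h3.trans (le_of_eq ?_)
        congr 2
        ext x
        constructor
        · intro hx
          exact ⟨by simpa using K.add_mem (hHK hx) hb, hx⟩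
        · exact fun hx => hx.2)
    rw [hrk K hK] at h2
    have h3 := (add_le_add_left h1 (rk H : WithBot ℕ)).trans h2
    have h4 : 1 + rk H ≤ rk K := by exact_mod_cast h3
    omega

end Rank

end Coords

end Interp

namespace Interp

/-! ### Ultrapowers and internal subgroups -/

section Ultrapowers

/-- The ultrapower along a nonprincipal ultrafilter on `ℕ`. -/
abbrev Ultrapower (X : Type*) : Type _ :=
  ((Filter.hyperfilter ℕ : Ultrafilter ℕ) : Filter ℕ).Product fun _ => X

noncomputable instance {X : Type*} [AddCommGroup X] : AddCommGroup (Ultrapower X) :=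
  inferInstanceAs (AddCommGroup (Filter.Germ (Filter.hyperfilter ℕ : Filter ℕ) X))

/-- The class of a sequence. -/
noncomputable def ucls {X : Type*} (x : ℕ → X) : Ultrapower X := Quotient.mk'' x

theorem exists_ucls {X : Type*} (x : Ultrapower X) : ∃ y, x = ucls y := by
  induction x using Quotient.inductionOn'
  exact ⟨_, rfl⟩

theorem exists_ucls_fun {X α : Type*} (x : α → Ultrapower X) :
    ∃ y : α → ℕ → X, x = fun i => ucls (y i) := by
  choose y hy using fun i => exists_ucls (x i)
  exact ⟨y, funext hy⟩

theorem ucls_eq {X : Type*} {x y : ℕ → X} :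
    ucls x = ucls y ↔ ∀ᶠ k in (Filter.hyperfilter ℕ : Filter ℕ), x k = y k := Quotient.eq''

theorem ucls_sub {X : Type*} [AddCommGroup X] (x y : ℕ → X) :
    ucls x - ucls y = ucls fun k => x k - y k := rfl

/-- The extension to the ultrapower of a sequence of sets. -/
def star {X α : Type*} (S : ℕ → Set (α → X)) : Set (α → Ultrapower X) :=
  {x | ∃ y : α → ℕ → X, x = (fun i => ucls (y i)) ∧
    ∀ᶠ k in (Filter.hyperfilter ℕ : Filter ℕ), (fun i => y i k) ∈ S k}

theorem mem_star {X α : Type*} [Finite α] {S : ℕ → Set (α → X)} {y : α → ℕ → X} :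
    (fun i => ucls (y i)) ∈ star S ↔
      ∀ᶠ k in (Filter.hyperfilter ℕ : Filter ℕ), (fun i => y i k) ∈ S k := by
  constructor
  · rintro ⟨z, hz, h⟩
    have h1 : ∀ᶠ k in (Filter.hyperfilter ℕ : Filter ℕ), ∀ i, y i k = z i k :=
      Filter.eventually_all.2 fun i => ucls_eq.1 (congrFun hz i)
    filter_upwards [h, h1] with k hk hk1
    rwa [funext hk1]
  · exact fun h => ⟨y, rfl, h⟩

/-- The internal subgroup of the ultrapower given by a sequence of subgroups. -/
def internal {X : Type*} [AddCommGroup X] (A : ℕ → AddSubgroup X) :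
    AddSubgroup (Ultrapower X) where
  carrier := {x | (fun _ : Unit => x) ∈ star fun k => {y : Unit → X | y () ∈ A k}}
  zero_mem' := (mem_star (y := fun _ _ => 0)).2 (Filter.Eventually.of_forall fun k => (A k).zero_mem)
  add_mem' {x y} hx hy := by
    obtain ⟨x, rfl⟩ := exists_ucls x
    obtain ⟨y, rfl⟩ := exists_ucls y
    have hx := (mem_star (y := fun _ => x)).1 hx
    have hy := (mem_star (y := fun _ => y)).1 hy
    refine (mem_star (y := fun _ k => x k + y k)).2 ?_
    filter_upwards [hx, hy] with k h1 h2
    exact (A k).add_mem h1 h2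
  neg_mem' {x} hx := by
    obtain ⟨x, rfl⟩ := exists_ucls x
    have hx := (mem_star (y := fun _ => x)).1 hx
    refine (mem_star (y := fun _ k => -x k)).2 ?_
    filter_upwards [hx] with k h1
    exact (A k).neg_mem h1

theorem ucls_mem_internal {X : Type*} [AddCommGroup X] {A : ℕ → AddSubgroup X} {x : ℕ → X} :
    ucls x ∈ internal A ↔ ∀ᶠ k in (Filter.hyperfilter ℕ : Filter ℕ), x k ∈ A k :=
  mem_star (y := fun _ => x)

theorem internal_inf {X : Type*} [AddCommGroup X] (A B : ℕ → AddSubgroup X) :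
    internal (fun k => A k ⊓ B k) = internal A ⊓ internal B := by
  ext x
  obtain ⟨x, rfl⟩ := exists_ucls x
  rw [AddSubgroup.mem_inf, ucls_mem_internal, ucls_mem_internal, ucls_mem_internal,
    ← Filter.eventually_and]
  rfl

/-- For fixed `m`, separated families chosen at the coordinates `k ≥ m`, which form a set in the
ultrafilter, give `m` separated elements of the ultrapower. -/
theorem internal_relIndex_eq_zero {X : Type*} [AddCommGroup X] {H A : ℕ → AddSubgroup X}
    (h : ∀ m k, m ≤ k → HasSeparated m (H k) (A k)) : (internal H).relIndex (internal A) = 0 := by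
  rw [relIndex_eq_zero_iff]
  intro m
  have h' : ∀ k, ∃ y : Fin m → X, m ≤ k →
      (∀ i, y i ∈ A k) ∧ Pairwise fun i j => y i - y j ∉ H k := by
    intro k
    by_cases hk : m ≤ k
    · obtain ⟨y, hy⟩ := h m k hk
      exact ⟨y, fun _ => hy⟩
    · exact ⟨0, fun h => (hk h).elim⟩
  choose y hy using h'
  have hlarge : ∀ᶠ k in (Filter.hyperfilter ℕ : Filter ℕ), m ≤ k := by
    have := Nat.hyperfilter_le_atTop (Filter.eventually_ge_atTop m)
    exact this
  refine ⟨fun i => ucls fun k => y k i, fun i => ?_, fun i j hij hm => ?_⟩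
  · rw [ucls_mem_internal]
    filter_upwards [hlarge] with k hk
    exact (hy k hk).1 i
  · rw [ucls_sub, ucls_mem_internal] at hm
    obtain ⟨k, hk, hk'⟩ := (hlarge.and hm).exists
    exact (hy k hk).2 hij hk'

variable {L : FirstOrder.Language.{u, v}} {M : Type w} [L.Structure M]

/-- Łoś's theorem, with each parameter replaced by its constant sequence. -/
theorem definable_star [Nonempty M] {α : Type*} [Finite α] {S : Set (α → M)}
    (hS : (Set.univ : Set M).Definable L S) :
    (Set.univ : Set (Ultrapower M)).Definable L (star fun _ => S) := by
  rw [Set.definable_iff_exists_formula_sum] at hS ⊢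
  obtain ⟨φ, rfl⟩ := hS
  refine ⟨φ.relabel (Sum.map (fun a : (Set.univ : Set M) => ⟨ucls fun _ => (a : M), trivial⟩) id), ?_⟩
  ext p
  obtain ⟨p, rfl⟩ := exists_ucls_fun p
  rw [mem_star]
  simp only [Set.mem_ofPred_eq, Formula.realize_relabel]
  have h := Ultraproduct.realize_formula_cast (u := Filter.hyperfilter ℕ) (M := fun _ : ℕ => M) φ
    (Sum.elim (fun a _ => (a : M)) p)
  have e1 : ((Sum.elim (fun a : (Set.univ : Set (Ultrapower M)) => (a : Ultrapower M))
      fun i => ucls (p i)) ∘ Sum.map (fun a : (Set.univ : Set M) => ⟨ucls fun _ => (a : M), trivial⟩)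
        id) = fun i => ucls (Sum.elim (fun (a : (Set.univ : Set M)) _ => (a : M)) p i) := by
    ext i
    rcases i with i | i <;> rfl
  rw [e1]
  refine Iff.trans ?_ h.symm
  refine Filter.eventually_congr (Filter.Eventually.of_forall fun k => iff_of_eq (congrArg _ ?_))
  ext i
  rcases i with i | i <;> rfl

namespace Coords

variable {G : Type*}

/-- The representation relation in the ultrapower. -/
def starRep {n : ℕ} (Rep : G → (Fin n → M) → Prop) (x : Ultrapower G)
    (p : Fin n → Ultrapower M) : Prop :=
  ∃ (y : ℕ → G) (q : Fin n → ℕ → M), x = ucls y ∧ p = (fun i => ucls (q i)) ∧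
    ∀ᶠ k in (Filter.hyperfilter ℕ : Filter ℕ), Rep (y k) fun i => q i k

theorem starRep_ucls {n : ℕ} {Rep : G → (Fin n → M) → Prop} {y : ℕ → G} {q : Fin n → ℕ → M} :
    starRep Rep (ucls y) (fun i => ucls (q i)) ↔
      ∀ᶠ k in (Filter.hyperfilter ℕ : Filter ℕ), Rep (y k) fun i => q i k := by
  constructor
  · rintro ⟨y', q', hy, hq, h⟩
    have h1 : ∀ᶠ k in (Filter.hyperfilter ℕ : Filter ℕ), ∀ i, q i k = q' i k :=
      Filter.eventually_all.2 fun i => ucls_eq.1 (congrFun hq i)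
    filter_upwards [h, h1, ucls_eq.1 hy] with k hk hk1 hk2
    rwa [hk2, funext hk1]
  · exact fun h => ⟨y, q, rfl, rfl, h⟩

theorem pull_starRep {n : ℕ} [Nonempty G] (Rep : G → (Fin n → M) → Prop) {α : Type*} [Finite α]
    (S : Set (α → G)) : pull (starRep Rep) (star fun _ => S) = star fun _ => pull Rep S := by
  classical
  ext p
  obtain ⟨p, rfl⟩ := exists_ucls_fun p
  rw [mem_star]
  constructor
  · rintro ⟨x, hx, hp⟩
    obtain ⟨x, rfl⟩ := exists_ucls_fun x
    rw [mem_star] at hx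
    have h : ∀ᶠ k in (Filter.hyperfilter ℕ : Filter ℕ), ∀ i, Rep (x i k) fun j => p (i, j) k :=
      Filter.eventually_all.2 fun i => starRep_ucls.1 (hp i)
    filter_upwards [hx, h] with k h1 h2
    exact ⟨_, h1, h2⟩
  · intro h
    have h' : ∀ k, ∃ x : α → G, (fun i => p i k) ∈ pull Rep S →
        x ∈ S ∧ ∀ i, Rep (x i) fun j => p (i, j) k := by
      intro k
      by_cases hk : (fun i => p i k) ∈ pull Rep S
      · obtain ⟨x, hx⟩ := hk
        exact ⟨x, fun _ => hx⟩
      · exact ⟨fun _ => Classical.arbitrary G, fun h => (hk h).elim⟩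
    choose x hx using h'
    refine ⟨fun i => ucls fun k => x k i, mem_star.2 ?_, fun i => starRep_ucls.2 ?_⟩
    · filter_upwards [h] with k hk
      exact (hx k hk).1
    · filter_upwards [h] with k hk
      exact (hx k hk).2 i

variable [AddCommGroup G]

/-- The presentation of the ultrapower of `G`. -/
def ultrapower [Nonempty M] (C : Coords L M G) : Coords L (Ultrapower M) (Ultrapower G) where
  n := C.n
  Rep := starRep C.Rep
  exists_rep x := by
    obtain ⟨x, rfl⟩ := exists_ucls x
    choose p hp using fun k => C.exists_rep (x k)
    exact ⟨fun i => ucls fun k => p k i, starRep_ucls.2 (Filter.Eventually.of_forall hp)⟩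
  unique {x y p} hx hy := by
    obtain ⟨x, rfl⟩ := exists_ucls x
    obtain ⟨y, rfl⟩ := exists_ucls y
    obtain ⟨p, rfl⟩ := exists_ucls_fun p
    rw [starRep_ucls] at hx hy
    rw [ucls_eq]
    filter_upwards [hx, hy] with k h1 h2
    exact C.unique h1 h2
  definable_add := by
    have h := definable_star C.definable_add
    rw [← pull_starRep] at h
    convert h using 2
    ext x
    obtain ⟨x, rfl⟩ := exists_ucls_fun x
    rw [mem_star]
    exact ucls_eq

theorem DefS.star [Nonempty M] {C : Coords L M G} {α : Type*} [Finite α] {S : Set (α → G)}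
    (hS : C.DefS S) : C.ultrapower.DefS (star fun _ => S) := by
  have h := definable_star hS
  rw [← pull_starRep] at h
  exact h

theorem DefSet.internal [Nonempty M] {C : Coords L M G} {D : AddSubgroup G}
    (hD : C.DefSet (D : Set G)) :
    C.ultrapower.DefSet (internal (fun _ => D) : Set (Ultrapower G)) := DefS.star hD

theorem DefFam.internal [Nonempty M] {C : Coords L M G} {H : G → AddSubgroup G}
    (hH : C.DefFam fun x => (H x : Set G)) (s : ℕ → G) :
    C.ultrapower.DefSet (internal (fun k => H (s k)) : Set (Ultrapower G)) := by
  have h := (DefS.star (hH.mem (Sum.inr () : Unit ⊕ Unit) (Sum.inl ()))).subst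
    fun _ => ucls s
  refine h.congr fun x => ?_
  obtain ⟨x, rfl⟩ := exists_ucls_fun x
  have e : (Sum.elim (fun i => ucls (x i)) fun _ => ucls s : Unit ⊕ Unit → Ultrapower G) =
      fun i => ucls (Sum.elim x (fun _ => s) i) := by
    ext i
    rcases i with i | i <;> rfl
  rw [Set.mem_ofPred_eq, Set.mem_ofPred_eq, e, mem_star]
  exact ucls_mem_internal

end Coords

end Ultrapowers

/-! ### Uniform bounds on finite indices -/

section Bounded

variable {L : FirstOrder.Language.{u, v}} {T : L.Theory}

/-- Since `K j` has finite index in `D`, an `H x` whose index in `D` is finite but exceeds `j` times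
that of `K j` must have index more than `j` in `K j`, by multiplicativity. -/
theorem exists_separating_sequence {G : Type*} [AddCommGroup G] {H : G → AddSubgroup G}
    {D : AddSubgroup G} (h : ∀ k : ℕ, ∃ x, (H x).relIndex D ≠ 0 ∧ k < (H x).relIndex D) :
    ∃ (s : ℕ → G) (K : ℕ → AddSubgroup G), K 0 = D ∧ (∀ j, K (j + 1) = K j ⊓ H (s j)) ∧
      ∀ j, j ≤ (H (s j)).relIndex (K j) := by
  have step : ∀ (j : ℕ) (K : {K : AddSubgroup G // K ≤ D ∧ K.relIndex D ≠ 0}), ∃ x,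
      (H x).relIndex D ≠ 0 ∧ j ≤ (H x).relIndex K.1 := by
    rintro j ⟨K, hKD, hK⟩
    obtain ⟨x, hx, hjx⟩ := h (j * K.relIndex D)
    refine ⟨x, hx, ?_⟩
    have h1 : (H x ⊓ K).relIndex D = (H x).relIndex K * K.relIndex D := by
      rw [← AddSubgroup.relIndex_mul_relIndex _ _ _ inf_le_right hKD, AddSubgroup.inf_relIndex_right]
    have h2 : (H x).relIndex D ≤ (H x ⊓ K).relIndex D :=
      AddSubgroup.relIndex_le_of_le_left inf_le_left (AddSubgroup.relIndex_inf_ne_zero hx hK)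
    exact (Nat.lt_of_mul_lt_mul_right (hjx.trans_le (h1 ▸ h2))).le
  choose next hnext using step
  let K : ℕ → {K : AddSubgroup G // K ≤ D ∧ K.relIndex D ≠ 0} := fun j =>
    Nat.rec ⟨D, le_rfl, by simp⟩ (fun j K => ⟨K.1 ⊓ H (next j K), inf_le_left.trans K.2.1,
      AddSubgroup.relIndex_inf_ne_zero K.2.2 (hnext j K).1⟩) j
  exact ⟨fun j => next j (K j), fun j => (K j).1, rfl, fun j => rfl, fun j => (hnext j (K j)).2⟩

theorem Coords.not_infinite_chain (hT : IsFiniteDimensionalTheory.{u, v, w} T)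
    {M : Theory.ModelType.{u, v, w} T} {G : Type*} [AddCommGroup G] (C : Coords L M G)
    (B : ℕ → AddSubgroup G) (hB : ∀ j, C.DefSet (B j : Set G)) (hle : ∀ j, B (j + 1) ≤ B j) :
    ∃ j, (B (j + 1)).relIndex (B j) ≠ 0 := by
  by_contra! h
  obtain ⟨dim, hdim⟩ := hT
  obtain ⟨rk, -, hlt⟩ := C.exists_rank hdim
  have hsum : ∀ j, rk (B j) + j ≤ rk (B 0) := by
    intro j
    induction j with
    | zero => exact le_rfl
    | succ j ih => have := hlt _ _ (hB (j + 1)) (hB j) (hle j) (h j); omega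
  have := hsum (rk (B 0) + 1)
  omega

/-- The ultrapower of a model. -/
noncomputable def ultrapowerModel (M : Theory.ModelType.{u, v, w} T) :
    Theory.ModelType.{u, v, w} T :=
  have : T.Model (Ultrapower M) := ⟨fun φ hφ => by
    rw [Ultraproduct.sentence_realize]
    exact Filter.Eventually.of_forall fun _ => Theory.realize_sentence_of_mem T hφ⟩
  Theory.ModelType.of T (Ultrapower M)

/-- The finite intersections of a sequence of subgroups along a shifted sequence. -/
def shiftInter {G : Type*} [AddCommGroup G] (D : AddSubgroup G) (K : ℕ → AddSubgroup G) :
    ℕ → ℕ → AddSubgroup G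
  | 0, _ => D
  | j + 1, k => shiftInter D K j k ⊓ K (k + j)

theorem Coords.defSet_internal_shiftInter {M : Type w} [L.Structure M] [Nonempty M]
    {G : Type*} [AddCommGroup G] {C : Coords L M G}
    {H : G → AddSubgroup G} (hH : C.DefFam fun x => (H x : Set G)) {D : AddSubgroup G}
    (hD : C.DefSet (D : Set G)) (s : ℕ → G) (j : ℕ) : C.ultrapower.DefSet
      (internal (shiftInter D (fun k => H (s k)) j) : Set (Ultrapower G)) := by
  induction j with
  | zero => exact hD.internal
  | succ j ih =>
    have : internal (shiftInter D (fun k => H (s k)) (j + 1)) =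
      internal (shiftInter D (fun k => H (s k)) j) ⊓ internal fun k => H (s (k + j)) :=
      internal_inf _ _
    rw [this]
    exact ih.inter (hH.internal _)

/-- Otherwise the ultrapower has an infinite chain with infinite-index steps. At coordinate `k`, its
`j`-th member intersects `D` with only `H (s k), …, H (s (k + j - 1))`, so it contains `K (k + j)`,
in which `H (s (k + j))` has index `0` or at least `k + j`. For fixed `j` this lower bound tends to
infinity with `k`. -/
theorem Coords.exists_relIndex_le (hT : IsFiniteDimensionalTheory.{u, v, w} T)
    {M : Theory.ModelType.{u, v, w} T} {G : Type*} [AddCommGroup G] (C : Coords L M G)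
    {H : G → AddSubgroup G} (hH : C.DefFam fun x => (H x : Set G)) {D : AddSubgroup G}
    (hD : C.DefSet (D : Set G)) :
    ∃ k, ∀ x, (H x).relIndex D ≠ 0 → (H x).relIndex D ≤ k := by
  by_contra! hcon
  obtain ⟨s, K, hK0, hKs, hsep⟩ := exists_separating_sequence hcon
  let A : ℕ → ℕ → AddSubgroup G := shiftInter D fun k => H (s k)
  have hAs : ∀ j, internal (A (j + 1)) = internal (A j) ⊓ internal fun k => H (s (k + j)) :=
    fun j => internal_inf _ _
  have hAK : ∀ j k, K (k + j) ≤ A j k := by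
    intro j
    induction j with
    | zero =>
      intro k
      change K k ≤ D
      induction k with
      | zero => exact hK0.le
      | succ k ih => rw [hKs]; exact inf_le_left.trans ih
    | succ j ih =>
      intro k
      rw [← add_assoc, hKs]
      exact inf_le_inf_right _ (ih k)
  obtain ⟨j, hj⟩ := Coords.not_infinite_chain hT (M := ultrapowerModel M) C.ultrapower
    (fun j => internal (A j)) (fun j => Coords.defSet_internal_shiftInter hH hD s j)
    (fun j => (hAs j).le.trans inf_le_left)
  refine hj ?_
  rw [hAs, AddSubgroup.inf_relIndex_left]
  refine internal_relIndex_eq_zero fun m k hmk => ?_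
  have h1 : HasSeparated m (H (s (k + j))) (K (k + j)) :=
    hasSeparated_iff.2 (Or.inr (by have := hsep (k + j); omega))
  obtain ⟨y, hy, hy'⟩ := h1
  exact ⟨y, fun i => hAK j k (hy i), hy'⟩

end Bounded

end Interp

namespace Interp

/-! ### Definable Lie rings give ranked systems -/

section Presentation

variable {L : FirstOrder.Language.{u, v}} {M : Type w} [L.Structure M]
variable {g : Type*} [LieRing g]

/-- The presentation of the additive group of a definable Lie ring. -/
def DefinableLieRing.coords (P : DefinableLieRing L M g) : Coords L M g where
  n := P.arity
  Rep x p := P.coord x = Quotient.mk P.rel p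
  exists_rep x := by
    obtain ⟨p, hp⟩ := Quotient.exists_rep (P.coord x)
    exact ⟨p, hp.symm⟩
  unique hx hy := P.coord_injective (hx.trans hy.symm)
  definable_add := by
    have h := P.definable_add.preimage_comp (fun i : Fin P.arity ⊕ Fin P.arity ⊕ Fin P.arity =>
      (Sum.elim (fun j => (0, j)) (Sum.elim (fun j => (1, j)) fun j => (2, j)) i :
        Fin 3 × Fin P.arity))
    convert h using 1
    ext p
    constructor
    · rintro ⟨x, hx, hp⟩
      refine ⟨x 0, x 1, hp 0, hp 1, ?_⟩
      rw [show x 0 + x 1 = x 2 from hx]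
      exact hp 2
    · rintro ⟨x, y, hx, hy, hxy⟩
      refine ⟨![x, y, x + y], rfl, fun i => ?_⟩
      fin_cases i
      · exact hx
      · exact hy
      · exact hxy

theorem DefinableLieRing.defS_lie (P : DefinableLieRing L M g) :
    P.coords.DefS {x : Fin 3 → g | ⁅x 0, x 1⁆ = x 2} := by
  have h := P.definable_lie.preimage_comp (fun i : Fin P.arity ⊕ Fin P.arity ⊕ Fin P.arity =>
    (Sum.elim (fun j => (0, j)) (Sum.elim (fun j => (1, j)) fun j => (2, j)) i :
      Fin 3 × Fin P.arity))
  change (Set.univ : Set M).Definable L (pull (n := P.arity)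
    (fun x p => P.coord x = Quotient.mk P.rel p) {x : Fin 3 → g | ⁅x 0, x 1⁆ = x 2})
  convert h using 1
  ext p
  constructor
  · rintro ⟨x, hx, hp⟩
    refine ⟨x 0, x 1, hp 0, hp 1, ?_⟩
    rw [show ⁅x 0, x 1⁆ = x 2 from hx]
    exact hp 2
  · rintro ⟨x, y, hx, hy, hxy⟩
    refine ⟨![x, y, ⁅x, y⁆], rfl, fun i => ?_⟩
    fin_cases i
    · exact hx
    · exact hy
    · exact hxy

theorem DefinableLieRing.definableSubset_iff (P : DefinableLieRing L M g) {S : Set g} :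
    P.DefinableSubset S ↔ P.coords.DefSet S := by
  change (Set.univ : Set M).Definable L {p : Fin P.arity → M | Quotient.mk P.rel p ∈ P.coord '' S} ↔
    (Set.univ : Set M).Definable L (pull (n := P.arity)
      (fun x p => P.coord x = Quotient.mk P.rel p) {x : Unit → g | x () ∈ S})
  constructor
  · intro h
    convert h.preimage_comp (fun j : Fin P.arity => ((), j)) using 1
    ext p
    constructor
    · rintro ⟨x, hx, hp⟩
      exact ⟨x (), hx, hp ()⟩
    · rintro ⟨x, hx, hp⟩
      exact ⟨fun _ => x, hx, fun _ => hp⟩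
  · intro h
    convert h.preimage_comp (fun j : Unit × Fin P.arity => j.2) using 1
    ext p
    constructor
    · rintro ⟨x, hx, hp⟩
      exact ⟨fun _ => x, hx, fun _ => hp⟩
    · rintro ⟨x, hx, hp⟩
      exact ⟨x (), hx, hp ()⟩

theorem DefinableLieRing.defFam_ctr (P : DefinableLieRing L M g) {N : AddSubgroup g}
    (hN : P.coords.DefSet (N : Set g)) : P.coords.DefFam fun x => (ctr N x : Set g) := by
  have h1 := P.defS_lie.reindex ![Sum.inl false, Sum.inl true, (Sum.inr () : Bool ⊕ Unit)]
  refine (h1.inter (hN.mem (Sum.inr ()))).exists.congr fun x => ?_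
  constructor
  · exact fun h => ⟨fun _ => ⁅x false, x true⁆, rfl, h⟩
  · rintro ⟨y, h, hy⟩
    have h' : ⁅x false, x true⁆ = y () := h
    change ⁅x false, x true⁆ ∈ N
    rw [h']
    exact hy

end Presentation

section System

variable {L : FirstOrder.Language.{u, v}} {T : L.Theory}

/-- With finite indices bounded by `k`, having finite index means having no `k + 1` separated
elements, a definable condition. -/
theorem defSet_act {M : Type w} [L.Structure M] {g : Type*} [LieRing g]
    (P : DefinableLieRing L M g) {N D : AddSubgroup g} (hN : P.coords.DefSet (N : Set g))
    (hD : P.coords.DefSet (D : Set g))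
    (hb : ∃ k, ∀ x, (ctr N x).relIndex D ≠ 0 → (ctr N x).relIndex D ≤ k) :
    P.coords.DefSet (act N D : Set g) := by
  obtain ⟨k, hk⟩ := hb
  refine (Coords.defSet_hasSeparated (P.defFam_ctr hN) hD (k + 1)).compl.congr fun x => ?_
  change (ctr N (x ())).relIndex D ≠ 0 ↔ ¬ HasSeparated (k + 1) (ctr N (x ())) D
  rw [hasSeparated_iff, not_or, not_le]
  exact ⟨fun h => ⟨h, Nat.lt_succ_of_le (hk _ h)⟩, fun h => h.1⟩

theorem exists_defSystem (hT : IsFiniteDimensionalTheory.{u, v, w} T)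
    {M : Theory.ModelType.{u, v, w} T} {g : Type*} [LieRing g] (P : DefinableLieRing L M g) :
    ∃ S : DefSystem g, ∀ H, S.Def H ↔ P.DefinableSubset (H : Set g) := by
  obtain ⟨dim, hdim⟩ := hT
  obtain ⟨rk, hmono, hlt⟩ := P.coords.exists_rank hdim
  have hb : ∀ {N D : AddSubgroup g}, P.coords.DefSet (N : Set g) → P.coords.DefSet (D : Set g) →
      ∃ k, ∀ x, (ctr N x).relIndex D ≠ 0 → (ctr N x).relIndex D ≤ k := fun hN hD =>
    P.coords.exists_relIndex_le ⟨dim, hdim⟩ (P.defFam_ctr hN) hD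
  exact ⟨{
    Def := fun H => P.coords.DefSet (H : Set g)
    rk := rk
    bot := P.coords.defSet_zero
    top := P.coords.defS_univ
    inf := fun hH hK => hH.inter hK
    of_relIndex_ne_zero := fun hH hHK h => hH.of_relIndex_ne_zero hHK h
    ctr := fun x hN => (P.defFam_ctr hN).apply x
    act := fun hN hD => defSet_act P hN hD (hb hN hD)
    bounded := hb
    rk_mono := fun hH hK h => hmono _ _ hH hK h
    rk_lt := fun hH hK h h' => hlt _ _ hH hK h h' },
    fun H => P.definableSubset_iff.symm⟩

end System

end Interp

theorem mainTheorem7 (L : FirstOrder.Language.{u, v}) (T : L.Theory)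
    (hT : Interp.IsFiniteDimensionalTheory.{u, v, w} T)
    (M : FirstOrder.Language.Theory.ModelType.{u, v, w} T)
    (g : Type*) [LieRing g] (P : Interp.DefinableLieRing L M g) :
    P.DefinableSubset (Interp.fittingIdeal g : Set g) ∧
      LieRing.IsNilpotent (Interp.fittingIdeal g) := by
  obtain ⟨S, hS⟩ := Interp.exists_defSystem hT P
  obtain ⟨h1, h2⟩ := S.fittingIdeal_def_and_isNilpotent
  exact ⟨(hS _).1 h1, h2⟩
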